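/- Manifolds are smooth, finite-dimensional and Hausdorff, and cochains are real-valued. Let $G\rightrightarrows M$ be a Lie groupoid with source $\mathsf s$ and target $\mathsf t$, and let $K\subset G$ be a wide Lie subgroupoid, i.e. a Lie groupoid $K\rightrightarrows M$ over the same base, with second countable arrow manifold, together with an injective immersion $K\hookrightarrow G$ that is a morphism of Lie groupoids over $\mathrm{id}_M$. For $p\ge 1$ let $B_pG=\{(g_1,\dots,g_p)\in G^p:\ \mathsf s(g_i)=\mathsf t(g_{i+1})\}$, with base points $m_0=\mathsf t(g_1)$ and $m_i=\mathsf s(g_i)$ for $1\le i\le p$, and let $B_0G=M$ (with base point $m_0=m$). Put $\mathsf C^p(G)=C^\infty(B_pG)$ with differential $\delta=\sum_{i=0}^{p+1}(-1)^i\partial_i^*$, where $\partial_i$ drops the $i$-th base point (composing the two adjacent arrows if $0<i<p+1$), and cup product $(f_1\cup f_2)(g_1,\dots,g_{p+q})=f_1(g_1,\dots,g_p)\,f_2(g_{p+1},\dots,g_{p+q})$. Let $\mathsf C^\bullet(G)^K\subset \mathsf C^\bullet(G)$ be the subcomplex of those $f$ that are, in each degree $p$, invariant under the $p+1$ commuting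 right actions of $K$ on $B_pG$; the $i$-th action of $a\in K$ with $\mathsf t(a)=m_i$ replaces $g_i,g_{i+1}$ by $g_ia,\ a^{-1}g_{i+1}$ (only one of these being present if $i=0$ or $i=p$), and for $p=0$ it maps $m$ to $\mathsf s(a)$. Let $\widetilde{\mathsf C}^\bullet(G)^K\subset \mathsf C^\bullet(G)^K$ be the normalized subcomplex of those $f$ with $f(g_1,\dots,g_p)=0$ whenever some $g_i\in K$. For $z\in M$ let $G_z$, $K_z$ be the isotropy groups of $G$, $K$ at $z$ (groupoids over $\{z\}$), and define $\mathsf C^\bullet(G_z)^{K_z}$ and $\widetilde{\mathsf C}^\bullet(G_z)^{K_z}$ in the same way. **Theorem.** Suppose that $K$ is transitive, i.e. any two points of $M$ are joined by an arrow of $K$, and let $z\in M$. For $f\in\mathsf C^p(G_z)^{K_z}$ and $(g_1,\dots,g_p)\in B_pG$ with base points $m_0,\dots,m_p$ put $$\mathrm{ext}(f)(g_1,\dots,g_p)=f(k_0^{-1}g_1k_1,\dots,k_{p-1}^{-1}g_pk_p),$$ where $k_0,\dots,k_p\in K$ are any arrows with $\mathsf s(k_i)=z$ and $\mathsf t(k_i)=m_i$.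 This is well defined (independent of the choice of the $k_i$), and $\mathrm{ext}\colon\mathsf C^\bullet(G_z)^{K_z}\to\mathsf C^\bullet(G)^K$ is an isomorphism of cochain complexes which respects the cup product. Its inverse is the restriction map $r\colon \mathsf C^\bullet(G)^K\to\mathsf C^\bullet(G_z)^{K_z}$, which is a cochain map and also respects the cup product. The same formula defines an isomorphism of cochain complexes $\widetilde{\mathsf C}^\bullet(G_z)^{K_z}\to\widetilde{\mathsf C}^\bullet(G)^K$ which respects the cup product, with inverse the restriction map, which is a cochain map and respects the cup product. -/

import Mathlib

open scoped Manifold ContDiff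

universe uM uG uK uEM uEG uEK

/-- A Lie groupoid `G ⇉ M`. The spaces `M` and `G` are manifolds modelled on the vector spaces
`EM` and `EG`. The product `mul g h` is only meaningful (and only constrained) for composable
pairs, i.e. when `src g = tgt h`; the pair `(g, h)` is then multiplied as "first `h`, then `g`". -/
structure LieGroupoid
    (EM : Type uEM) [NormedAddCommGroup EM] [NormedSpace ℝ EM]
    (EG : Type uEG) [NormedAddCommGroup EG] [NormedSpace ℝ EG]
    (M : Type uM) [TopologicalSpace M] [ChartedSpace EM M]
    (G : Type uG) [TopologicalSpace G] [ChartedSpace EG G] where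
  /-- source -/
  src : G → M
  /-- target -/
  tgt : G → M
  /-- units -/
  unit : M → G
  /-- inversion -/
  inv : G → G
  /-- multiplication (of composable arrows) -/
  mul : G → G → G
  src_unit : ∀ m, src (unit m) = m
  tgt_unit : ∀ m, tgt (unit m) = m
  src_inv : ∀ g, src (inv g) = tgt g
  tgt_inv : ∀ g, tgt (inv g) = src g
  src_mul : ∀ g h, src g = tgt h → src (mul g h) = src h
  tgt_mul : ∀ g h, src g = tgt h → tgt (mul g h) = tgt g
  mul_assoc : ∀ g h k, src g = tgt h → src h = tgt k → mul (mul g h) k = mul g (mul h k)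
  unit_mul : ∀ g, mul (unit (tgt g)) g = g
  mul_unit : ∀ g, mul g (unit (src g)) = g
  inv_mul : ∀ g, mul (inv g) g = unit (src g)
  mul_inv : ∀ g, mul g (inv g) = unit (tgt g)
  isSubmersion_src : Manifold.IsSubmersion 𝓘(ℝ, EG) 𝓘(ℝ, EM) ∞ src
  isSubmersion_tgt : Manifold.IsSubmersion 𝓘(ℝ, EG) 𝓘(ℝ, EM) ∞ tgt
  contMDiff_unit : ContMDiff 𝓘(ℝ, EM) 𝓘(ℝ, EG) ∞ unit
  contMDiff_inv : ContMDiff 𝓘(ℝ, EG) 𝓘(ℝ, EG) ∞ inv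
  /-- multiplication is smooth on the submanifold of composable pairs of `G × G` -/
  contMDiffOn_mul : ContMDiffOn (𝓘(ℝ, EG).prod 𝓘(ℝ, EG)) 𝓘(ℝ, EG) ∞
    (fun x : G × G => mul x.1 x.2) {x | src x.1 = tgt x.2}

namespace LieGroupoid

variable {EM : Type uEM} [NormedAddCommGroup EM] [NormedSpace ℝ EM]
  {EG : Type uEG} [NormedAddCommGroup EG] [NormedSpace ℝ EG]
  {EK : Type uEK} [NormedAddCommGroup EK] [NormedSpace ℝ EK]
  {M : Type uM} [TopologicalSpace M] [ChartedSpace EM M]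
  {G : Type uG} [TopologicalSpace G] [ChartedSpace EG G]
  {K : Type uK} [TopologicalSpace K] [ChartedSpace EK K]

/-- A wide Lie subgroupoid `K` of `G`: a Lie groupoid over the same base `M`, together with a
morphism of Lie groupoids `incl : K → G` over the identity of `M` which is an injective
immersion. (The topology and smooth structure of `K` need not be induced from `G`.) -/
structure WideSubgroupoid (𝒢 : LieGroupoid EM EG M G)
    (EK : Type uEK) [NormedAddCommGroup EK] [NormedSpace ℝ EK]
    (K : Type uK) [TopologicalSpace K] [ChartedSpace EK K]
    extends LieGroupoid EM EK M K where
  /-- the inclusion -/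
  incl : K → G
  incl_injective : Function.Injective incl
  isImmersion_incl : Manifold.IsImmersion 𝓘(ℝ, EK) 𝓘(ℝ, EG) ∞ incl
  src_incl : ∀ k, 𝒢.src (incl k) = src k
  tgt_incl : ∀ k, 𝒢.tgt (incl k) = tgt k
  incl_mul : ∀ k l, src k = tgt l → incl (mul k l) = 𝒢.mul (incl k) (incl l)

/-- A Lie groupoid is transitive if it has only one orbit: any two points of the base are joined
by an arrow. -/
def IsTransitive (𝒢 : LieGroupoid EM EG M G) : Prop :=
  ∀ m n : M, ∃ g : G, 𝒢.src g = m ∧ 𝒢.tgt g = n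

/-! ### The nerve -/

/-- Tuples of `p + 1` base points `(m₀, …, m_p)` and `p` arrows `(g₁, …, g_p)`. -/
abbrev Tuples (M : Type uM) (G : Type uG) (p : ℕ) : Type (max uM uG) :=
  (Fin (p + 1) → M) × (Fin p → G)

/-- The product smooth structure of `M ^ (p + 1) × G ^ p`. -/
noncomputable abbrev tuplesModel (EM : Type uEM) [NormedAddCommGroup EM] [NormedSpace ℝ EM]
    (EG : Type uEG) [NormedAddCommGroup EG] [NormedSpace ℝ EG] (p : ℕ) :=
  (ModelWithCorners.pi (fun _ : Fin (p + 1) => 𝓘(ℝ, EM))).prod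
    (ModelWithCorners.pi (fun _ : Fin p => 𝓘(ℝ, EG)))

variable (𝒢 : LieGroupoid EM EG M G)

/-- For a set `Z ⊆ M` of base points, the `p`-arrows of the restriction of the groupoid `G` to
`Z` (the full subgroupoid of arrows with source and target in `Z`). A `p`-arrow
`g₁, …, g_p` is recorded together with its base points `m₀, …, m_p`, so that the case `p = 0` is
not special: `B₀` is the base. The arrow `g_{j+1} = x.2 j` runs from `m_{j+1}` to `m_j`.

* For `Z = Set.univ` this is `B_p G`, as a submanifold of `M ^ (p + 1) × G ^ p`.
* For `Z = {z}` this is `B_p (G_z) = (G_z) ^ p` for the isotropy group `G_z`, an embedded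
  submanifold of `G`. -/
def nerve (Z : Set M) (p : ℕ) : Set (Tuples M G p) :=
  {x | (∀ i, x.1 i ∈ Z) ∧ ∀ j, 𝒢.tgt (x.2 j) = x.1 j.castSucc ∧ 𝒢.src (x.2 j) = x.1 j.succ}

/-- The `i`-th face map: drop the `i`-th base point. It sends `(g₁, …, g_{p+1})` to
`(g₂, …, g_{p+1})`, `(g₁, …, g_i g_{i+1}, …, g_{p+1})` or `(g₁, …, g_p)` for `i = 0`,
`0 < i < p + 1` or `i = p + 1`. -/
def face {p : ℕ} (i : Fin (p + 2)) (x : Tuples M G (p + 1)) : Tuples M G p :=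
  (fun a => x.1 (i.succAbove a),
   fun j => if (j : ℕ) + 1 < i then x.2 j.castSucc
     else if (j : ℕ) + 1 = i then 𝒢.mul (x.2 j.castSucc) (x.2 j.succ)
     else x.2 j.succ)

/-- The `i`-th (right) action of an arrow `a` with target `m_i`: it sends `(g₁, …, g_p)` to
`(g₁, …, g_i a, a⁻¹ g_{i+1}, …, g_p)`, with only one of the two factors present for `i = 0` and
`i = p`; the `i`-th base point becomes `src a`. For `p = 0` it sends `m₀` to `src a`. -/
def act {p : ℕ} (i : Fin (p + 1)) (a : G) (x : Tuples M G p) : Tuples M G p :=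
  (Function.update x.1 i (𝒢.src a),
   fun j => if j.castSucc = i then 𝒢.mul (𝒢.inv a) (x.2 j)
     else if j.succ = i then 𝒢.mul (x.2 j) a
     else x.2 j)

/-- `(g₁, …, g_p) ↦ (k₀⁻¹ g₁ k₁, …, k_{p-1}⁻¹ g_p k_p)`, where `k_i` has target `m_i`. -/
def conj {p : ℕ} (k : Fin (p + 1) → G) (x : Tuples M G p) : Tuples M G p :=
  (fun i => 𝒢.src (k i),
   fun j => 𝒢.mul (𝒢.mul (𝒢.inv (k j.castSucc)) (x.2 j)) (k j.succ))

/-- `(g₁, …, g_{p+q}) ↦ (g₁, …, g_p)`. -/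
def front (p q : ℕ) (x : Tuples M G (p + q)) : Tuples M G p :=
  (fun a => x.1 ⟨a, by omega⟩, fun j => x.2 ⟨j, by omega⟩)

/-- `(g₁, …, g_{p+q}) ↦ (g_{p+1}, …, g_{p+q})`. -/
def back (p q : ℕ) (x : Tuples M G (p + q)) : Tuples M G q :=
  (fun a => x.1 ⟨p + a, by omega⟩, fun j => x.2 ⟨p + j, by omega⟩)

section NerveLemmas

variable {𝒢} {Z : Set M}

theorem face_mem {p : ℕ} (i : Fin (p + 2)) {x : Tuples M G (p + 1)}
    (hx : x ∈ 𝒢.nerve Z (p + 1)) : 𝒢.face i x ∈ 𝒢.nerve Z p := by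
  obtain ⟨hZ, hx⟩ := hx
  refine ⟨fun a => hZ _, fun j => ?_⟩
  have h1 := hx j.castSucc
  have h2 := hx j.succ
  have e : j.castSucc.succ = j.succ.castSucc := rfl
  have hc : 𝒢.src (x.2 j.castSucc) = 𝒢.tgt (x.2 j.succ) := by rw [h1.2, h2.1, e]
  rcases lt_trichotomy ((j : ℕ) + 1) i with h | h | h
  · have a1 : i.succAbove j.castSucc = j.castSucc.castSucc :=
      Fin.succAbove_of_castSucc_lt _ _ (by rw [Fin.lt_def]; simp; omega)
    have a2 : i.succAbove j.succ = j.castSucc.succ := by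
      rw [e]; exact Fin.succAbove_of_castSucc_lt _ _ (by rw [Fin.lt_def]; simpa using h)
    simp only [face, if_pos h, a1, a2]
    exact h1
  · have a1 : i.succAbove j.castSucc = j.castSucc.castSucc :=
      Fin.succAbove_of_castSucc_lt _ _ (by rw [Fin.lt_def]; simp; omega)
    have a2 : i.succAbove j.succ = j.succ.succ :=
      Fin.succAbove_of_le_castSucc _ _ (by rw [Fin.le_def]; simp; omega)
    have h' : ¬ ((j : ℕ) + 1 < i) := by omega
    simp only [face, if_neg h', if_pos h, a1, a2]
    rw [𝒢.tgt_mul _ _ hc, 𝒢.src_mul _ _ hc]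
    exact ⟨h1.1, h2.2⟩
  · have a1 : i.succAbove j.castSucc = j.succ.castSucc := by
      rw [← e]; exact Fin.succAbove_of_le_castSucc _ _ (by rw [Fin.le_def]; simp; omega)
    have a2 : i.succAbove j.succ = j.succ.succ :=
      Fin.succAbove_of_le_castSucc _ _ (by rw [Fin.le_def]; simp; omega)
    have h' : ¬ ((j : ℕ) + 1 < i) := by omega
    have h'' : ¬ ((j : ℕ) + 1 = i) := by omega
    simp only [face, if_neg h', if_neg h'', a1, a2]
    exact h2

theorem act_mem {p : ℕ} {i : Fin (p + 1)} {a : G} {x : Tuples M G p}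
    (hx : x ∈ 𝒢.nerve Z p) (ht : 𝒢.tgt a = x.1 i) (hs : 𝒢.src a ∈ Z) :
    𝒢.act i a x ∈ 𝒢.nerve Z p := by
  obtain ⟨hZ, hx⟩ := hx
  refine ⟨fun b => ?_, fun j => ?_⟩
  · by_cases hb : b = i
    · subst hb; simpa [act] using hs
    · simpa [act, Function.update_of_ne hb] using hZ b
  · have h1 := hx j
    by_cases hj : j.castSucc = i
    · have hj' : j.succ ≠ i := by rw [← hj]; exact (Fin.castSucc_lt_succ).ne'
      have hc : 𝒢.src (𝒢.inv a) = 𝒢.tgt (x.2 j) := by rw [𝒢.src_inv, ht, h1.1, hj]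
      simp only [act, if_pos hj]
      rw [𝒢.tgt_mul _ _ hc, 𝒢.src_mul _ _ hc, 𝒢.tgt_inv, hj, Function.update_self,
        Function.update_of_ne hj']
      exact ⟨rfl, h1.2⟩
    · by_cases hj' : j.succ = i
      · have hc : 𝒢.src (x.2 j) = 𝒢.tgt a := by rw [ht, h1.2, hj']
        simp only [act, if_neg hj, if_pos hj']
        rw [𝒢.tgt_mul _ _ hc, 𝒢.src_mul _ _ hc, hj', Function.update_self,
          Function.update_of_ne hj]
        exact ⟨h1.1, rfl⟩
      · simp only [act, if_neg hj, if_neg hj']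
        rw [Function.update_of_ne hj, Function.update_of_ne hj']
        exact h1

theorem conj_mem {Z' : Set M} {p : ℕ} {k : Fin (p + 1) → G} {x : Tuples M G p}
    (hx : x ∈ 𝒢.nerve Z' p) (ht : ∀ i, 𝒢.tgt (k i) = x.1 i) (hs : ∀ i, 𝒢.src (k i) ∈ Z) :
    𝒢.conj k x ∈ 𝒢.nerve Z p := by
  refine ⟨hs, fun j => ?_⟩
  have h1 := hx.2 j
  have hc : 𝒢.src (𝒢.inv (k j.castSucc)) = 𝒢.tgt (x.2 j) := by rw [𝒢.src_inv, ht, h1.1]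
  have hc' : 𝒢.src (𝒢.mul (𝒢.inv (k j.castSucc)) (x.2 j)) = 𝒢.tgt (k j.succ) := by
    rw [𝒢.src_mul _ _ hc, ht, h1.2]
  simp only [conj]
  rw [𝒢.tgt_mul _ _ hc', 𝒢.src_mul _ _ hc', 𝒢.tgt_mul _ _ hc, 𝒢.tgt_inv]
  exact ⟨rfl, rfl⟩

theorem front_mem {p q : ℕ} {x : Tuples M G (p + q)} (hx : x ∈ 𝒢.nerve Z (p + q)) :
    front p q x ∈ 𝒢.nerve Z p :=
  ⟨fun _ => hx.1 _, fun j => hx.2 ⟨j, by omega⟩⟩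

theorem back_mem {p q : ℕ} {x : Tuples M G (p + q)} (hx : x ∈ 𝒢.nerve Z (p + q)) :
    back p q x ∈ 𝒢.nerve Z q :=
  ⟨fun _ => hx.1 _, fun j => hx.2 ⟨p + j, by omega⟩⟩

theorem nerve_mono {Z' : Set M} (h : Z ⊆ Z') (p : ℕ) : 𝒢.nerve Z p ⊆ 𝒢.nerve Z' p :=
  fun _ hx => ⟨fun i => h (hx.1 i), hx.2⟩

/-! Every `p`-arrow is of the form `(c₀⁻¹ c₁, …, c_{p-1}⁻¹ c_p)` with arrows `c_i` having a
common target. -/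

/-- `(c₀⁻¹ c₁, …, c_{p-1}⁻¹ c_p)`. -/
def quot (𝒢 : LieGroupoid EM EG M G) {p : ℕ} (c : Fin (p + 1) → G) : Tuples M G p :=
  (fun i => 𝒢.src (c i), fun j => 𝒢.mul (𝒢.inv (c j.castSucc)) (c j.succ))

theorem inv_mul_cancel_left {a b : G} (h : 𝒢.src a = 𝒢.tgt b) :
    𝒢.mul (𝒢.inv a) (𝒢.mul a b) = b := by
  rw [← 𝒢.mul_assoc _ _ _ (𝒢.src_inv a) h, 𝒢.inv_mul, h, 𝒢.unit_mul]

theorem mul_inv_cancel_left {a b : G} (h : 𝒢.tgt a = 𝒢.tgt b) :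
    𝒢.mul a (𝒢.mul (𝒢.inv a) b) = b := by
  rw [← 𝒢.mul_assoc _ _ _ (𝒢.tgt_inv a).symm ((𝒢.src_inv a).trans h), 𝒢.mul_inv, h, 𝒢.unit_mul]

theorem exists_quot {p : ℕ} {x : Tuples M G p} (hx : x ∈ 𝒢.nerve Z p) :
    ∃ c : Fin (p + 1) → G, (∀ i j, 𝒢.tgt (c i) = 𝒢.tgt (c j)) ∧ 𝒢.quot c = x := by
  let c : Fin (p + 1) → G :=
    fun i => Fin.induction (motive := fun _ => G) (𝒢.unit (x.1 0))
      (fun j g => 𝒢.mul g (x.2 j)) i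
  have c0 : c 0 = 𝒢.unit (x.1 0) := rfl
  have cs : ∀ j : Fin p, c j.succ = 𝒢.mul (c j.castSucc) (x.2 j) := fun j => by
    simp [c, Fin.induction_succ]
  have hs : ∀ i, 𝒢.src (c i) = x.1 i ∧ 𝒢.tgt (c i) = x.1 0 := by
    intro i
    induction i using Fin.induction with
    | zero => rw [c0, 𝒢.src_unit, 𝒢.tgt_unit]; exact ⟨rfl, rfl⟩
    | succ j ih =>
      have hc : 𝒢.src (c j.castSucc) = 𝒢.tgt (x.2 j) := by rw [ih.1, (hx.2 j).1]
      rw [cs, 𝒢.src_mul _ _ hc, 𝒢.tgt_mul _ _ hc]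
      exact ⟨(hx.2 j).2, ih.2⟩
  refine ⟨c, fun i j => by rw [(hs i).2, (hs j).2], Prod.ext (funext fun i => (hs i).1) ?_⟩
  funext j
  have hc : 𝒢.src (c j.castSucc) = 𝒢.tgt (x.2 j) := by rw [(hs _).1, (hx.2 j).1]
  simp only [quot]
  rw [cs, inv_mul_cancel_left hc]

theorem face_quot {p : ℕ} (i : Fin (p + 2)) {c : Fin (p + 2) → G}
    (hc : ∀ i j, 𝒢.tgt (c i) = 𝒢.tgt (c j)) :
    𝒢.face i (𝒢.quot c) = 𝒢.quot (c ∘ i.succAbove) := by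
  refine Prod.ext rfl (funext fun j => ?_)
  have e : j.castSucc.succ = j.succ.castSucc := rfl
  rcases lt_trichotomy ((j : ℕ) + 1) i with h | h | h
  · have a1 : i.succAbove j.castSucc = j.castSucc.castSucc :=
      Fin.succAbove_of_castSucc_lt _ _ (by rw [Fin.lt_def]; simp; omega)
    have a2 : i.succAbove j.succ = j.castSucc.succ := by
      rw [e]; exact Fin.succAbove_of_castSucc_lt _ _ (by rw [Fin.lt_def]; simpa using h)
    simp only [face, quot, if_pos h, Function.comp, a1, a2]
  · have a1 : i.succAbove j.castSucc = j.castSucc.castSucc :=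
      Fin.succAbove_of_castSucc_lt _ _ (by rw [Fin.lt_def]; simp; omega)
    have a2 : i.succAbove j.succ = j.succ.succ :=
      Fin.succAbove_of_le_castSucc _ _ (by rw [Fin.le_def]; simp; omega)
    have h' : ¬ ((j : ℕ) + 1 < i) := by omega
    simp only [face, quot, if_neg h', if_pos h, Function.comp, a1, a2, e]
    have s1 : 𝒢.src (𝒢.inv (c j.succ.castSucc)) = 𝒢.tgt (c j.succ.succ) := by
      rw [𝒢.src_inv]; exact hc _ _
    have s2 : 𝒢.src (𝒢.inv (c j.castSucc.castSucc)) = 𝒢.tgt (c j.succ.castSucc) := by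
      rw [𝒢.src_inv]; exact hc _ _
    rw [𝒢.mul_assoc _ _ _ s2 (by rw [𝒢.tgt_mul _ _ s1, 𝒢.tgt_inv]),
      mul_inv_cancel_left (hc _ _)]
  · have a1 : i.succAbove j.castSucc = j.succ.castSucc := by
      rw [← e]; exact Fin.succAbove_of_le_castSucc _ _ (by rw [Fin.le_def]; simp; omega)
    have a2 : i.succAbove j.succ = j.succ.succ :=
      Fin.succAbove_of_le_castSucc _ _ (by rw [Fin.le_def]; simp; omega)
    have h' : ¬ ((j : ℕ) + 1 < i) := by omega
    have h'' : ¬ ((j : ℕ) + 1 = i) := by omega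
    simp only [face, quot, if_neg h', if_neg h'', Function.comp, a1, a2]

theorem inv_mul_rev {a b d : G} (h : 𝒢.src a = 𝒢.tgt b) (hd : 𝒢.tgt a = 𝒢.tgt d) :
    𝒢.mul (𝒢.inv (𝒢.mul a b)) d = 𝒢.mul (𝒢.inv b) (𝒢.mul (𝒢.inv a) d) := by
  have e1 : 𝒢.src (𝒢.inv a) = 𝒢.tgt d := by rw [𝒢.src_inv, hd]
  have e2 : 𝒢.src (𝒢.inv b) = 𝒢.tgt (𝒢.mul (𝒢.inv a) d) := by
    rw [𝒢.tgt_mul _ _ e1, 𝒢.src_inv, 𝒢.tgt_inv, h]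
  have e3 : 𝒢.mul (𝒢.mul a b) (𝒢.mul (𝒢.inv b) (𝒢.mul (𝒢.inv a) d)) = d := by
    rw [𝒢.mul_assoc _ _ _ h (by rw [𝒢.tgt_mul _ _ e2, 𝒢.tgt_inv]),
      mul_inv_cancel_left (by rw [← e2, 𝒢.src_inv]), mul_inv_cancel_left hd]
  conv_lhs => rw [← e3]
  rw [inv_mul_cancel_left]
  rw [𝒢.src_mul _ _ h, 𝒢.tgt_mul _ _ e2, 𝒢.tgt_inv]

theorem act_quot {p : ℕ} {i : Fin (p + 1)} {a : G} {c : Fin (p + 1) → G}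
    (hc : ∀ i j, 𝒢.tgt (c i) = 𝒢.tgt (c j)) (ha : 𝒢.tgt a = 𝒢.src (c i)) :
    𝒢.act i a (𝒢.quot c) = 𝒢.quot (Function.update c i (𝒢.mul (c i) a)) := by
  refine Prod.ext (funext fun b => ?_) (funext fun j => ?_)
  · by_cases hb : b = i
    · subst hb; simp [act, quot, 𝒢.src_mul _ _ ha.symm]
    · simp [act, quot, Function.update_of_ne hb]
  · by_cases hj : j.castSucc = i
    · have hj' : j.succ ≠ i := by rw [← hj]; exact (Fin.castSucc_lt_succ).ne'
      simp only [act, quot, if_pos hj]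
      rw [Function.update_of_ne hj', hj, Function.update_self, inv_mul_rev ha.symm (hc _ _)]
    · by_cases hj' : j.succ = i
      · simp only [act, quot, if_neg hj, if_pos hj']
        rw [Function.update_of_ne hj, hj', Function.update_self]
        exact 𝒢.mul_assoc _ _ _ (by rw [𝒢.src_inv]; exact hc _ _) ha.symm
      · simp only [act, quot, if_neg hj, if_neg hj']
        rw [Function.update_of_ne hj, Function.update_of_ne hj']

theorem face_face {p : ℕ} (i : Fin (p + 3)) (j : Fin (p + 2)) {x : Tuples M G (p + 2)}
    (hx : x ∈ 𝒢.nerve Z (p + 2)) :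
    𝒢.face (j.predAbove i) (𝒢.face (i.succAbove j) x) = 𝒢.face j (𝒢.face i x) := by
  obtain ⟨c, hc, rfl⟩ := exists_quot hx
  rw [face_quot _ hc, face_quot _ hc,
    face_quot (c := c ∘ (i.succAbove j).succAbove) _ (fun _ _ => hc _ _),
    face_quot (c := c ∘ i.succAbove) _ (fun _ _ => hc _ _)]
  congr 1
  funext k
  simp only [Function.comp]
  rw [Fin.succAbove_succAbove_succAbove_predAbove]

theorem face_act_self {p : ℕ} {i : Fin (p + 2)} {a : G} {x : Tuples M G (p + 1)}
    (hx : x ∈ 𝒢.nerve Z (p + 1)) (ha : 𝒢.tgt a = x.1 i) :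
    𝒢.face i (𝒢.act i a x) = 𝒢.face i x := by
  obtain ⟨c, hc, rfl⟩ := exists_quot hx
  have ha' : 𝒢.tgt a = 𝒢.src (c i) := ha
  have hc' : ∀ j, 𝒢.tgt (Function.update c i (𝒢.mul (c i) a) j) = 𝒢.tgt (c i) := by
    intro j
    by_cases hj : j = i
    · subst hj; rw [Function.update_self, 𝒢.tgt_mul _ _ ha'.symm]
    · rw [Function.update_of_ne hj]; exact hc _ _
  rw [act_quot hc ha', face_quot _ hc, face_quot _ (fun k l => by rw [hc', hc'])]
  congr 1
  funext k
  simp [Function.comp]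

theorem face_act_succAbove {p : ℕ} {j : Fin (p + 2)} {i : Fin (p + 1)} {a : G}
    {x : Tuples M G (p + 1)}
    (hx : x ∈ 𝒢.nerve Z (p + 1)) (ha : 𝒢.tgt a = x.1 (j.succAbove i)) :
    𝒢.face j (𝒢.act (j.succAbove i) a x) = 𝒢.act i a (𝒢.face j x) := by
  obtain ⟨c, hc, rfl⟩ := exists_quot hx
  set i' := j.succAbove i with hi'
  have ha' : 𝒢.tgt a = 𝒢.src (c i') := ha
  have hc' : ∀ j, 𝒢.tgt (Function.update c i' (𝒢.mul (c i') a) j) = 𝒢.tgt (c i') := by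
    intro j
    by_cases hj : j = i'
    · subst hj; rw [Function.update_self, 𝒢.tgt_mul _ _ ha'.symm]
    · rw [Function.update_of_ne hj]; exact hc _ _
  rw [act_quot hc ha', face_quot _ hc, face_quot _ (fun k l => by rw [hc', hc']),
    act_quot (c := c ∘ j.succAbove) (fun _ _ => hc _ _) ha']
  congr 1
  funext k
  by_cases hk : k = i
  · subst hk; simp [Function.comp, hi']
  · have : j.succAbove k ≠ i' := fun h => hk (Fin.succAbove_right_injective h)
    simp [Function.comp, Function.update_of_ne hk, Function.update_of_ne this]

/-- If the arrow `g_{j+1}` is used to act at `m_j`, then dropping `m_{j+1}` afterwards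
is the same as dropping `m_j` from the original tuple. -/
theorem face_act_arrow {p : ℕ} (j : Fin (p + 1)) {x : Tuples M G (p + 1)}
    (hx : x ∈ 𝒢.nerve Z (p + 1)) :
    𝒢.face j.succ (𝒢.act j.castSucc (x.2 j) x) = 𝒢.face j.castSucc x := by
  have ht := (hx.2 j).1
  obtain ⟨c, hc, rfl⟩ := exists_quot hx
  have ha : 𝒢.tgt ((𝒢.quot c).2 j) = 𝒢.src (c j.castSucc) := ht
  have hm : 𝒢.mul (c j.castSucc) ((𝒢.quot c).2 j) = c j.succ := mul_inv_cancel_left (hc _ _)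
  rw [act_quot hc ha, hm, face_quot _ hc, face_quot]
  · congr 1
    funext k
    simp only [Function.comp]
    rcases lt_trichotomy k j with h | h | h
    · have b1 : j.succ.succAbove k = k.castSucc :=
        Fin.succAbove_of_castSucc_lt _ _ (by rw [Fin.lt_def] at *; simp; omega)
      have b2 : j.castSucc.succAbove k = k.castSucc :=
        Fin.succAbove_of_castSucc_lt _ _ (by rw [Fin.lt_def] at *; simpa using h)
      rw [b1, b2, Function.update_of_ne]
      intro h'; exact h.ne (Fin.castSucc_injective _ h')
    · subst h
      rw [Fin.succAbove_succ_self, Function.update_self, Fin.succAbove_castSucc_self]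
    · have b1 : j.succ.succAbove k = k.succ :=
        Fin.succAbove_of_le_castSucc _ _ (by rw [Fin.lt_def] at h; rw [Fin.le_def]; simp; omega)
      have b2 : j.castSucc.succAbove k = k.succ :=
        Fin.succAbove_of_le_castSucc _ _ (by rw [Fin.lt_def] at h; rw [Fin.le_def]; simp; omega)
      rw [b1, b2, Function.update_of_ne]
      intro h'
      have := congrArg Fin.val h'
      rw [Fin.lt_def] at h
      simp at this; omega
  · intro k l
    by_cases hk : k = j.castSucc <;> by_cases hl : l = j.castSucc <;>
      simp [Function.update, hk, hl] <;> exact hc _ _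

/-- Dropping a base point other than `m_j`, `m_{j+1}` keeps the arrow `g_{j+1}`. -/
theorem exists_face_arrow {p : ℕ} (j : Fin (p + 1)) (i : Fin (p + 2)) (x : Tuples M G (p + 1))
    (h1 : i ≠ j.castSucc) (h2 : i ≠ j.succ) : ∃ l, (𝒢.face i x).2 l = x.2 j := by
  have h1' : (i : ℕ) ≠ j := fun h => h1 (Fin.ext h)
  have h2' : (i : ℕ) ≠ j + 1 := fun h => h2 (Fin.ext h)
  have := i.isLt
  have := j.isLt
  by_cases h : (j : ℕ) + 1 < i
  · refine ⟨⟨j, by omega⟩, ?_⟩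
    simp only [face, if_pos h]
    rfl
  · refine ⟨⟨(j : ℕ) - 1, by omega⟩, ?_⟩
    have e1 : ¬ ((j : ℕ) - 1 + 1 < i) := by omega
    have e2 : ¬ ((j : ℕ) - 1 + 1 = i) := by omega
    simp only [face, if_neg e1, if_neg e2]
    exact congrArg x.2 (Fin.ext (by simp; omega))

theorem front_act {p q : ℕ} (i : Fin (p + q + 1)) (a : G) (x : Tuples M G (p + q)) :
    front p q (𝒢.act i a x) =
      if h : (i : ℕ) < p + 1 then 𝒢.act ⟨i, h⟩ a (front p q x) else front p q x := by
  split_ifs with h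
  · refine Prod.ext (funext fun b => ?_) (funext fun j => ?_)
    · simp only [front, act, Function.update_apply, Fin.ext_iff]
    · simp only [front, act, Fin.ext_iff, Fin.val_castSucc, Fin.val_succ]
  · refine Prod.ext (funext fun b => ?_) (funext fun j => ?_)
    · simp only [front, act, Function.update_apply, Fin.ext_iff]
      rw [if_neg (by omega)]
    · simp only [front, act, Fin.ext_iff, Fin.val_castSucc, Fin.val_succ]
      rw [if_neg (by omega), if_neg (by omega)]

theorem back_act {p q : ℕ} (i : Fin (p + q + 1)) (a : G) (x : Tuples M G (p + q)) :
    back p q (𝒢.act i a x) =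
      if h : p ≤ (i : ℕ) then 𝒢.act ⟨i - p, by omega⟩ a (back p q x) else back p q x := by
  split_ifs with h
  · refine Prod.ext (funext fun b => ?_) (funext fun j => ?_)
    · have e : (p + (b : ℕ) = i) = ((b : ℕ) = i - p) := propext (by omega)
      simp only [back, act, Function.update_apply, Fin.ext_iff, e]
    · have e : (p + (j : ℕ) = i) = ((j : ℕ) = i - p) := propext (by omega)
      have e' : (p + (j : ℕ) + 1 = i) = ((j : ℕ) + 1 = i - p) := propext (by omega)
      simp only [back, act, Fin.ext_iff, Fin.val_castSucc, Fin.val_succ, e, e']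
  · refine Prod.ext (funext fun b => ?_) (funext fun j => ?_)
    · simp only [back, act, Function.update_apply, Fin.ext_iff]
      rw [if_neg (by omega)]
    · simp only [back, act, Fin.ext_iff, Fin.val_castSucc, Fin.val_succ]
      rw [if_neg (by omega), if_neg (by omega)]

end NerveLemmas

/-! ### Smooth cochains -/

/-- Smoothness of a function on `B_p` of the groupoid `G` restricted to `Z`. For `Z = Set.univ` and
`Z = {z}` this `B_p` is an embedded submanifold of the manifold `M ^ (p + 1) × G ^ p`; in a
submanifold chart, `ContMDiffOn` on it is ordinary smoothness of the function on the submanifold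
(only the values of `F` on `B_p` matter). -/
def IsSmooth (Z : Set M) (p : ℕ) (f : 𝒢.nerve Z p → ℝ) : Prop :=
  ∃ F : Tuples M G p → ℝ,
    ContMDiffOn (tuplesModel EM EG p) 𝓘(ℝ, ℝ) ∞ F (𝒢.nerve Z p) ∧ ∀ x, F x.1 = f x

/-- The differential `δ f = ∑ i, (-1) ^ i ∂_i^* f`. -/
def diff (Z : Set M) (p : ℕ) : (𝒢.nerve Z p → ℝ) →ₗ[ℝ] (𝒢.nerve Z (p + 1) → ℝ) where
  toFun f x := ∑ i : Fin (p + 2), (-1 : ℝ) ^ (i : ℕ) * f ⟨𝒢.face i x.1, face_mem i x.2⟩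
  map_add' f g := by
    funext x
    simp [mul_add, Finset.sum_add_distrib]
  map_smul' r f := by
    funext x
    simp [Finset.mul_sum, mul_left_comm]

/-- The cup product `(f₁ ∪ f₂)(g₁, …, g_{p+q}) = f₁(g₁, …, g_p) f₂(g_{p+1}, …, g_{p+q})`. -/
def cup {Z : Set M} {p q : ℕ} (f₁ : 𝒢.nerve Z p → ℝ) (f₂ : 𝒢.nerve Z q → ℝ) :
    𝒢.nerve Z (p + q) → ℝ :=
  fun x => f₁ ⟨front p q x.1, front_mem x.2⟩ * f₂ ⟨back p q x.1, back_mem x.2⟩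

section SmoothLemmas

theorem contMDiffWithinAt_pi_iff {ι : Type*} [Fintype ι]
    {E F N P : Type*} [NormedAddCommGroup E] [NormedSpace ℝ E] {H : Type*} [TopologicalSpace H]
    {I : ModelWithCorners ℝ E H} [TopologicalSpace N] [ChartedSpace H N]
    [NormedAddCommGroup F] [NormedSpace ℝ F] [TopologicalSpace P] [ChartedSpace F P]
    {n : WithTop ℕ∞} {φ : N → ι → P} {s : Set N} {x : N} :
    ContMDiffWithinAt I (ModelWithCorners.pi (fun _ : ι => 𝓘(ℝ, F))) n φ s x ↔
      ∀ i, ContMDiffWithinAt I 𝓘(ℝ, F) n (fun y => φ y i) s x := by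
  simp only [contMDiffWithinAt_iff, forall_and]
  rw [continuousWithinAt_pi, contDiffWithinAt_pi]
  rfl

variable {𝒢} {Z : Set M}

theorem contMDiffOn_point (p : ℕ) (s : Set (Tuples M G p)) (i : Fin (p + 1)) :
    ContMDiffOn (tuplesModel EM EG p) 𝓘(ℝ, EM) ∞ (fun x : Tuples M G p => x.1 i) s :=
  fun x _ => contMDiffWithinAt_pi_iff.1 (contMDiff_fst.contMDiffOn (s := s) x ‹_›) i

theorem contMDiffOn_arrow (p : ℕ) (s : Set (Tuples M G p)) (j : Fin p) :
    ContMDiffOn (tuplesModel EM EG p) 𝓘(ℝ, EG) ∞ (fun x : Tuples M G p => x.2 j) s :=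
  fun x _ => contMDiffWithinAt_pi_iff.1 (contMDiff_snd.contMDiffOn (s := s) x ‹_›) j

theorem contMDiffOn_tuples {p q : ℕ} {s : Set (Tuples M G p)} {φ : Tuples M G p → Tuples M G q}
    (h1 : ∀ i, ContMDiffOn (tuplesModel EM EG p) 𝓘(ℝ, EM) ∞ (fun x => (φ x).1 i) s)
    (h2 : ∀ j, ContMDiffOn (tuplesModel EM EG p) 𝓘(ℝ, EG) ∞ (fun x => (φ x).2 j) s) :
    ContMDiffOn (tuplesModel EM EG p) (tuplesModel EM EG q) ∞ φ s :=
  fun x hx => ContMDiffWithinAt.prodMk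
    (contMDiffWithinAt_pi_iff.2 fun i => h1 i x hx)
    (contMDiffWithinAt_pi_iff.2 fun j => h2 j x hx)

theorem contMDiffOn_face {p : ℕ} (i : Fin (p + 2)) :
    ContMDiffOn (tuplesModel EM EG (p + 1)) (tuplesModel EM EG p) ∞ (𝒢.face i)
      (𝒢.nerve Z (p + 1)) := by
  refine contMDiffOn_tuples (fun a => contMDiffOn_point _ _ _) (fun j => ?_)
  simp only [face]
  split_ifs
  · exact contMDiffOn_arrow _ _ _
  · refine 𝒢.contMDiffOn_mul.comp
      ((contMDiffOn_arrow _ _ j.castSucc).prodMk (contMDiffOn_arrow _ _ j.succ)) fun x hx => ?_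
    have h1 := hx.2 j.castSucc
    have h2 := hx.2 j.succ
    exact h1.2.trans h2.1.symm
  · exact contMDiffOn_arrow _ _ _

theorem IsSmooth.add {p : ℕ} {f g : 𝒢.nerve Z p → ℝ} (hf : 𝒢.IsSmooth Z p f)
    (hg : 𝒢.IsSmooth Z p g) : 𝒢.IsSmooth Z p (f + g) := by
  obtain ⟨F, hF, hf⟩ := hf
  obtain ⟨F', hF', hg⟩ := hg
  exact ⟨F + F', hF.add hF', fun x => by simp [hf, hg]⟩

theorem IsSmooth.zero {p : ℕ} : 𝒢.IsSmooth Z p 0 :=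
  ⟨fun _ => 0, contMDiffOn_const, fun _ => rfl⟩

theorem IsSmooth.smul {p : ℕ} {f : 𝒢.nerve Z p → ℝ} (r : ℝ) (hf : 𝒢.IsSmooth Z p f) :
    𝒢.IsSmooth Z p (r • f) := by
  obtain ⟨F, hF, hf⟩ := hf
  exact ⟨fun x => r * F x, (contMDiffOn_const (c := r)).mul hF, fun x => by simp [hf]⟩

theorem IsSmooth.diff {p : ℕ} {f : 𝒢.nerve Z p → ℝ} (hf : 𝒢.IsSmooth Z p f) :
    𝒢.IsSmooth Z (p + 1) (𝒢.diff Z p f) := by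
  obtain ⟨F, hF, hf⟩ := hf
  refine ⟨fun x => ∑ i : Fin (p + 2), (-1 : ℝ) ^ (i : ℕ) * F (𝒢.face i x), ?_, fun x => ?_⟩
  · refine contMDiffOn_finsetSum fun i _ => (contMDiffOn_const).mul
      (hF.comp (contMDiffOn_face i) fun x hx => face_mem i hx)
  · exact Finset.sum_congr rfl fun i _ => by rw [← hf]

theorem IsSmooth.cup {p q : ℕ} {f₁ : 𝒢.nerve Z p → ℝ} {f₂ : 𝒢.nerve Z q → ℝ}
    (h₁ : 𝒢.IsSmooth Z p f₁) (h₂ : 𝒢.IsSmooth Z q f₂) :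
    𝒢.IsSmooth Z (p + q) (𝒢.cup f₁ f₂) := by
  obtain ⟨F₁, hF₁, h₁⟩ := h₁
  obtain ⟨F₂, hF₂, h₂⟩ := h₂
  refine ⟨fun x => F₁ (front p q x) * F₂ (back p q x), ?_, fun x => ?_⟩
  · have e₁ : ContMDiffOn (tuplesModel EM EG (p + q)) (tuplesModel EM EG p) ∞ (front p q)
        (𝒢.nerve Z (p + q)) :=
      contMDiffOn_tuples (fun _ => contMDiffOn_point _ _ _) (fun _ => contMDiffOn_arrow _ _ _)
    have e₂ : ContMDiffOn (tuplesModel EM EG (p + q)) (tuplesModel EM EG q) ∞ (back p q)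
        (𝒢.nerve Z (p + q)) :=
      contMDiffOn_tuples (fun _ => contMDiffOn_point _ _ _) (fun _ => contMDiffOn_arrow _ _ _)
    exact (hF₁.comp e₁ fun x hx => front_mem hx).mul (hF₂.comp e₂ fun x hx => back_mem hx)
  · simp only [LieGroupoid.cup, ← h₁, ← h₂]

theorem IsSmooth.restrict {Z' : Set M} (h : Z ⊆ Z') {p : ℕ} {f : 𝒢.nerve Z' p → ℝ}
    (hf : 𝒢.IsSmooth Z' p f) :
    𝒢.IsSmooth Z p (fun x => f ⟨x.1, nerve_mono h p x.2⟩) := by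
  obtain ⟨F, hF, hf⟩ := hf
  exact ⟨F, hF.mono (nerve_mono h p), fun x => hf ⟨x.1, _⟩⟩

theorem diff_diff {p : ℕ} (f : 𝒢.nerve Z p → ℝ) : 𝒢.diff Z (p + 1) (𝒢.diff Z p f) = 0 := by
  funext x
  simp only [diff, LinearMap.coe_mk, AddHom.coe_mk, Finset.mul_sum, Pi.zero_apply]
  rw [Finset.sum_sigma' Finset.univ (fun _ => Finset.univ)
    (fun (i : Fin (p + 3)) (j : Fin (p + 2)) => (-1 : ℝ) ^ (i : ℕ) * ((-1 : ℝ) ^ (j : ℕ) *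
      f ⟨𝒢.face j (𝒢.face i x.1), face_mem j (face_mem i x.2)⟩))]
  refine Finset.sum_involution (fun a _ => ⟨a.1.succAbove a.2, a.2.predAbove a.1⟩) ?_ ?_ ?_ ?_
  · rintro ⟨i, j⟩ -
    have e := face_face i j x.2
    have h := Fin.neg_one_pow_succAbove_add_predAbove (R := ℝ) i j
    rw [pow_add, pow_add] at h
    simp only [e]
    rw [← _root_.mul_assoc, ← _root_.mul_assoc, h]
    ring
  · rintro ⟨i, j⟩ - -
    intro h
    have := congrArg Sigma.fst h
    exact Fin.succAbove_ne _ _ this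
  · intros; simp
  · rintro ⟨i, j⟩ -
    simp [Fin.succAbove_succAbove_predAbove, Fin.predAbove_predAbove_succAbove]

end SmoothLemmas

/-! ### Cochains relative to a wide subgroupoid -/

variable {𝒢} (𝒦 : 𝒢.WideSubgroupoid EK K)

namespace WideSubgroupoid

/-- Invariance under the `p + 1` commuting actions of (the restriction to `Z` of) `K`. -/
def IsInvariant (Z : Set M) (p : ℕ) (f : 𝒢.nerve Z p → ℝ) : Prop :=
  ∀ (i : Fin (p + 1)) (k : K) (x : 𝒢.nerve Z p) (ht : 𝒢.tgt (𝒦.incl k) = x.1.1 i)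
    (hs : 𝒢.src (𝒦.incl k) ∈ Z), f ⟨𝒢.act i (𝒦.incl k) x.1, act_mem x.2 ht hs⟩ = f x

/-- `f (g₁, …, g_p) = 0` whenever some `g_i` is in `K`. -/
def IsNormalized (Z : Set M) (p : ℕ) (f : 𝒢.nerve Z p → ℝ) : Prop :=
  ∀ x : 𝒢.nerve Z p, (∃ j k, x.1.2 j = 𝒦.incl k) → f x = 0

/-- The space of smooth `K`-invariant `p`-cochains, for the groupoids restricted to `Z`. It is
`C^p(G)^K` for `Z = Set.univ` and `C^p(G_z)^{K_z}` for `Z = {z}`. -/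
def cochains (Z : Set M) (p : ℕ) : Submodule ℝ (𝒢.nerve Z p → ℝ) where
  carrier := {f | 𝒢.IsSmooth Z p f ∧ 𝒦.IsInvariant Z p f}
  add_mem' hf hg := ⟨hf.1.add hg.1, fun i k x ht hs => by
    simp only [Pi.add_apply, hf.2 i k x ht hs, hg.2 i k x ht hs]⟩
  zero_mem' := ⟨IsSmooth.zero, fun _ _ _ _ _ => rfl⟩
  smul_mem' r f hf := ⟨hf.1.smul r, fun i k x ht hs => by
    simp only [Pi.smul_apply, hf.2 i k x ht hs]⟩

/-- The space of normalized smooth `K`-invariant `p`-cochains. -/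
def normCochains (Z : Set M) (p : ℕ) : Submodule ℝ (𝒢.nerve Z p → ℝ) where
  carrier := {f | f ∈ 𝒦.cochains Z p ∧ 𝒦.IsNormalized Z p f}
  add_mem' hf hg := ⟨add_mem hf.1 hg.1, fun x hx => by simp [hf.2 x hx, hg.2 x hx]⟩
  zero_mem' := ⟨zero_mem _, fun _ _ => rfl⟩
  smul_mem' r f hf := ⟨Submodule.smul_mem _ r hf.1, fun x hx => by simp [hf.2 x hx]⟩

section ClosureLemmas

variable {𝒦} {Z : Set M}

theorem diff_mem {p : ℕ} {f : 𝒢.nerve Z p → ℝ} (hf : f ∈ 𝒦.cochains Z p) :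
    𝒢.diff Z p f ∈ 𝒦.cochains Z (p + 1) := by
  refine ⟨hf.1.diff, fun i k x ht hs => ?_⟩
  simp only [diff, LinearMap.coe_mk, AddHom.coe_mk]
  refine Finset.sum_congr rfl fun j _ => ?_
  congr 1
  by_cases hj : i = j
  · subst hj
    congr 1
    exact Subtype.ext (face_act_self x.2 ht)
  · obtain ⟨i, rfl⟩ := Fin.exists_succAbove_eq hj
    have := hf.2 i k ⟨𝒢.face j x.1, face_mem j x.2⟩ ht hs
    rw [← this]
    congr 1
    exact Subtype.ext (face_act_succAbove x.2 ht)

theorem diff_mem_norm {p : ℕ} {f : 𝒢.nerve Z p → ℝ} (hf : f ∈ 𝒦.normCochains Z p) :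
    𝒢.diff Z p f ∈ 𝒦.normCochains Z (p + 1) := by
  refine ⟨diff_mem hf.1, ?_⟩
  rintro x ⟨j, k, hk⟩
  have hne : j.castSucc ≠ j.succ := (Fin.castSucc_lt_succ).ne
  have key : f ⟨𝒢.face j.succ x.1, face_mem _ x.2⟩ =
      f ⟨𝒢.face j.castSucc x.1, face_mem _ x.2⟩ := by
    have ht : 𝒢.tgt (𝒦.incl k) = x.1.1 j.castSucc := by rw [← hk]; exact (x.2.2 j).1
    have hs : 𝒢.src (𝒦.incl k) ∈ Z := by rw [← hk, (x.2.2 j).2]; exact x.2.1 _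
    have e : j.succ.succAbove j = j.castSucc := Fin.succAbove_succ_self j
    have ht' : 𝒢.tgt (𝒦.incl k) = x.1.1 (j.succ.succAbove j) := by rw [e, ht]
    have h1 := hf.1.2 j k ⟨𝒢.face j.succ x.1, face_mem _ x.2⟩ ht' hs
    rw [← h1]
    congr 1
    refine Subtype.ext ?_
    change 𝒢.act j (𝒦.incl k) (𝒢.face j.succ x.1) = 𝒢.face j.castSucc x.1
    rw [← face_act_succAbove x.2 ht', e, ← hk]
    exact face_act_arrow j x.2
  simp only [diff, LinearMap.coe_mk, AddHom.coe_mk]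
  rw [← Finset.sum_subset (Finset.subset_univ {j.castSucc, j.succ}), Finset.sum_pair hne, key]
  · simp only [Fin.val_castSucc, Fin.val_succ, pow_succ]
    ring
  · intro i _ hi
    simp only [Finset.mem_insert, Finset.mem_singleton, not_or] at hi
    obtain ⟨l, hl⟩ := exists_face_arrow (𝒢 := 𝒢) j i x.1 hi.1 hi.2
    rw [hf.2 ⟨_, face_mem i x.2⟩ ⟨l, k, hl.trans hk⟩, mul_zero]

theorem cup_mem {p q : ℕ} {f₁ : 𝒢.nerve Z p → ℝ} {f₂ : 𝒢.nerve Z q → ℝ}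
    (h₁ : f₁ ∈ 𝒦.cochains Z p) (h₂ : f₂ ∈ 𝒦.cochains Z q) :
    𝒢.cup f₁ f₂ ∈ 𝒦.cochains Z (p + q) := by
  refine ⟨h₁.1.cup h₂.1, fun i k x ht hs => ?_⟩
  simp only [cup]
  congr 1
  · simp only [front_act]
    by_cases h : (i : ℕ) < p + 1
    · simp only [dif_pos h]
      exact h₁.2 ⟨i, h⟩ k ⟨front p q x.1, front_mem x.2⟩ ht hs
    · simp only [dif_neg h]
  · simp only [back_act]
    by_cases h : p ≤ (i : ℕ)
    · simp only [dif_pos h]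
      refine h₂.2 ⟨i - p, by omega⟩ k ⟨back p q x.1, back_mem x.2⟩ ?_ hs
      rw [ht]
      simp only [back]
      exact congrArg x.1.1 (Fin.ext (by simp; omega))
    · simp only [dif_neg h]

theorem cup_mem_norm {p q : ℕ} {f₁ : 𝒢.nerve Z p → ℝ} {f₂ : 𝒢.nerve Z q → ℝ}
    (h₁ : f₁ ∈ 𝒦.normCochains Z p) (h₂ : f₂ ∈ 𝒦.normCochains Z q) :
    𝒢.cup f₁ f₂ ∈ 𝒦.normCochains Z (p + q) := by
  refine ⟨cup_mem h₁.1 h₂.1, ?_⟩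
  rintro x ⟨j, k, hk⟩
  simp only [cup]
  by_cases h : (j : ℕ) < p
  · rw [h₁.2 ⟨front p q x.1, front_mem x.2⟩ ⟨⟨j, h⟩, k, hk⟩, zero_mul]
  · have e : (⟨p + (j - p), by omega⟩ : Fin (p + q)) = j := by ext; simp; omega
    rw [h₂.2 ⟨back p q x.1, back_mem x.2⟩ ⟨⟨j - p, by omega⟩, k, ?_⟩, mul_zero]
    simp only [back, e, hk]

theorem restrict_mem {Z' : Set M} (h : Z ⊆ Z') {p : ℕ} {f : 𝒢.nerve Z' p → ℝ}
    (hf : f ∈ 𝒦.cochains Z' p) :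
    (fun x : 𝒢.nerve Z p => f ⟨x.1, nerve_mono h p x.2⟩) ∈ 𝒦.cochains Z p :=
  ⟨hf.1.restrict h, fun i k x ht hs => hf.2 i k ⟨x.1, nerve_mono h p x.2⟩ ht (h hs)⟩

theorem restrict_mem_norm {Z' : Set M} (h : Z ⊆ Z') {p : ℕ} {f : 𝒢.nerve Z' p → ℝ}
    (hf : f ∈ 𝒦.normCochains Z' p) :
    (fun x : 𝒢.nerve Z p => f ⟨x.1, nerve_mono h p x.2⟩) ∈ 𝒦.normCochains Z p :=
  ⟨restrict_mem h hf.1, fun x hx => hf.2 ⟨x.1, nerve_mono h p x.2⟩ hx⟩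

end ClosureLemmas

/-- The cup product of invariant cochains. -/
def cup {Z : Set M} {p q : ℕ} (f₁ : 𝒦.cochains Z p) (f₂ : 𝒦.cochains Z q) :
    𝒦.cochains Z (p + q) :=
  ⟨𝒢.cup f₁.1 f₂.1, cup_mem f₁.2 f₂.2⟩

/-- The cup product of normalized invariant cochains. -/
def normCup {Z : Set M} {p q : ℕ} (f₁ : 𝒦.normCochains Z p) (f₂ : 𝒦.normCochains Z q) :
    𝒦.normCochains Z (p + q) :=
  ⟨𝒢.cup f₁.1 f₂.1, cup_mem_norm f₁.2 f₂.2⟩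

/-- The complex of invariant cochains of the groupoids restricted to `Z`. -/
def complexOn (Z : Set M) : CochainComplex (ModuleCat.{max uM uG} ℝ) ℕ :=
  CochainComplex.of (fun p => ModuleCat.of ℝ (𝒦.cochains Z p))
    (fun p => ModuleCat.ofHom ((𝒢.diff Z p).restrict fun _ hf => diff_mem hf))
    (fun p => by
      refine ModuleCat.hom_ext (LinearMap.ext fun f => ?_)
      exact Subtype.ext (diff_diff f.1))

/-- The complex of normalized invariant cochains of the groupoids restricted to `Z`. -/
def normComplexOn (Z : Set M) : CochainComplex (ModuleCat.{max uM uG} ℝ) ℕ :=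
  CochainComplex.of (fun p => ModuleCat.of ℝ (𝒦.normCochains Z p))
    (fun p => ModuleCat.ofHom ((𝒢.diff Z p).restrict fun _ hf => diff_mem_norm hf))
    (fun p => by
      refine ModuleCat.hom_ext (LinearMap.ext fun f => ?_)
      exact Subtype.ext (diff_diff f.1))

theorem complexOn_d (Z : Set M) (p : ℕ) : (𝒦.complexOn Z).d p (p + 1) =
    ModuleCat.ofHom ((𝒢.diff Z p).restrict fun _ hf => diff_mem hf) :=
  CochainComplex.of_d (fun p => ModuleCat.of ℝ (𝒦.cochains Z p))
    (fun p => ModuleCat.ofHom ((𝒢.diff Z p).restrict fun _ hf => diff_mem hf)) p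

theorem normComplexOn_d (Z : Set M) (p : ℕ) : (𝒦.normComplexOn Z).d p (p + 1) =
    ModuleCat.ofHom ((𝒢.diff Z p).restrict fun _ hf => diff_mem_norm hf) :=
  CochainComplex.of_d (fun p => ModuleCat.of ℝ (𝒦.normCochains Z p))
    (fun p => ModuleCat.ofHom ((𝒢.diff Z p).restrict fun _ hf => diff_mem_norm hf)) p

/-- The Lie groupoid complex relative to `K`, i.e. `C(G)^K`. -/
abbrev relComplex : CochainComplex (ModuleCat.{max uM uG} ℝ) ℕ := 𝒦.complexOn Set.univ

/-- The complex `C(G_z)^{K_z}` of the isotropy group `G_z` relative to `K_z`. -/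
abbrev isotropyComplex (z : M) : CochainComplex (ModuleCat.{max uM uG} ℝ) ℕ := 𝒦.complexOn {z}

/-- The normalized subcomplex of `C(G)^K`. -/
abbrev normRelComplex : CochainComplex (ModuleCat.{max uM uG} ℝ) ℕ := 𝒦.normComplexOn Set.univ

/-- The normalized subcomplex of `C(G_z)^{K_z}`. -/
abbrev normIsotropyComplex (z : M) : CochainComplex (ModuleCat.{max uM uG} ℝ) ℕ :=
  𝒦.normComplexOn {z}

variable {𝒦} in
/-- The linear map in degree `p` underlying a cochain map. -/
def mapAt {Z Z' : Set M} (φ : 𝒦.complexOn Z ⟶ 𝒦.complexOn Z') (p : ℕ) :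
    𝒦.cochains Z p →ₗ[ℝ] 𝒦.cochains Z' p :=
  (φ.f p).hom

variable {𝒦} in
/-- The linear map in degree `p` underlying a cochain map of normalized complexes. -/
def normMapAt {Z Z' : Set M} (φ : 𝒦.normComplexOn Z ⟶ 𝒦.normComplexOn Z') (p : ℕ) :
    𝒦.normCochains Z p →ₗ[ℝ] 𝒦.normCochains Z' p :=
  (φ.f p).hom

/-- Restriction of cochains to the isotropy group at `z`, as a cochain map. -/
def restrict (z : M) : 𝒦.relComplex ⟶ 𝒦.isotropyComplex z :=
  CochainComplex.ofHom
    (fun p => ModuleCat.ofHom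
      { toFun := fun f => ⟨_, restrict_mem (Set.subset_univ {z}) f.2⟩
        map_add' := fun _ _ => rfl
        map_smul' := fun _ _ => rfl })
    (fun _ => by rw [complexOn_d, complexOn_d]; rfl)

/-- Restriction of normalized cochains to the isotropy group at `z`, as a cochain map. -/
def normRestrict (z : M) : 𝒦.normRelComplex ⟶ 𝒦.normIsotropyComplex z :=
  CochainComplex.ofHom
    (fun p => ModuleCat.ofHom
      { toFun := fun f => ⟨_, restrict_mem_norm (Set.subset_univ {z}) f.2⟩
        map_add' := fun _ _ => rfl
        map_smul' := fun _ _ => rfl })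
    (fun _ => by rw [normComplexOn_d, normComplexOn_d]; rfl)

/-- The `p`-arrow `(k₀⁻¹ g₁ k₁, …, k_{p-1}⁻¹ g_p k_p)` of the isotropy group at `z`, where
`k_i` is an arrow of `K` from `z` to `m_i`. -/
def conjTo {z : M} {p : ℕ} (x : 𝒢.nerve Set.univ p) (k : Fin (p + 1) → K)
    (hs : ∀ i, 𝒦.src (k i) = z) (ht : ∀ i, 𝒦.tgt (k i) = x.1.1 i) : 𝒢.nerve {z} p :=
  ⟨𝒢.conj (fun i => 𝒦.incl (k i)) x.1,
    conj_mem x.2 (fun i => (𝒦.tgt_incl _).trans (ht i)) (fun i => (𝒦.src_incl _).trans (hs i))⟩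

end WideSubgroupoid

end LieGroupoid

/-!
The inverse of the extension map is restriction, and all the algebra follows from writing a
`p`-arrow as `x = (c₀⁻¹ c₁, …, c_{p-1}⁻¹ c_p)`. In these terms the `i`-th action of `a` replaces
`c_i` by `c_i a`, conjugation by `k₀, …, k_p` replaces every `c_i` by `c_i k_i`, and a face drops
one `c_i`. So a `K`-invariant cochain does not change if all the `c_i` are multiplied on the right
by arrows of `K` (`IsInvariant.quot_mul`). This shows that extension is well defined
(`IsInvariant.conjTo_eq`), that its values are invariant (`IsInvariant.extend`), and that it is
inverse to restriction (`extend_restrict`, `restrict_extend`).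

The analytic point is that the extension of a smooth cochain is smooth (`isSmooth_extend`). The
arrows `k_i` from `z` to `m_i` have to depend smoothly on `m_i`, locally: the target map `t` of `K`
must have smooth local sections with values in the source fibre `s⁻¹(z)`
(`IsTransitive.exists_local_section`). By the inverse function theorem it suffices that `t`
restricted to `s⁻¹(z)` is a submersion, i.e. that `dt (ker ds)`, called `orbitTangent` below, is
the whole tangent space of the base.

* The rank of `t` on source fibres is constant. Right translations identify source fibres and
  commute with `t`, so they preserve `dt (ker ds)`; likewise left translations preserve
  `ds (ker dt)`. Both spaces have dimension `dim ker ds - dim (ker ds ∩ ker dt)`, and in a transitive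
  groupoid any two arrows are related by a left and a right translation
  (`IsTransitive.finrank_orbitTangent_eq`).
* A map of constant rank `r` has local images of Hausdorff dimension at most `r`
  (`exists_mem_nhds_dimH_image_le_of_constant_rank`). As `K` is second countable and `t` maps
  `s⁻¹(z)` onto the base, an open subset of the model space of the base is a countable union of
  sets of dimension at most `r`, so `r` is the dimension of the base
  (`IsTransitive.orbitTangent_eq_top`).
-/

/-! ### Maps of constant rank and local sections -/

section Calculus

open Topology Module

variable {E E' : Type*} [NormedAddCommGroup E] [NormedSpace ℝ E]
  [NormedAddCommGroup E'] [NormedSpace ℝ E']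

/-- A `C¹` map of constant rank `r` has local images of Hausdorff dimension at most `r`: in the
coordinates `(q ∘ g, π)`, where `q` projects onto the range of the derivative at `a` and `π` onto
its kernel, the map does not depend on the second variable. -/
theorem exists_mem_nhds_dimH_image_le_of_constant_rank [FiniteDimensional ℝ E]
    {g : E → E'} {U : Set E} (hU : IsOpen U)
    (hg : ContDiffOn ℝ 1 g U) {r : ℕ}
    (hr : ∀ x ∈ U, finrank ℝ (LinearMap.range (fderiv ℝ g x : E →ₗ[ℝ] E')) = r)
    {a : E} (ha : a ∈ U) : ∃ N ∈ 𝓝 a, dimH (g '' N) ≤ r := by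
  have hgat : ∀ x ∈ U, ContDiffAt ℝ 1 g x := fun x hx => hg.contDiffAt (hU.mem_nhds hx)
  set A : E →L[ℝ] E' := fderiv ℝ g a
  have hAder : HasFDerivAt g A a := ((hgat a ha).differentiableAt (by simp)).hasFDerivAt
  let R := LinearMap.range (A : E →ₗ[ℝ] E')
  let N := LinearMap.ker (A : E →ₗ[ℝ] E')
  obtain ⟨q, hq⟩ : ∃ q : E' →L[ℝ] R, ∀ y : R, q y = y :=
    Submodule.ClosedComplemented.of_finiteDimensional R
  obtain ⟨π, hπ⟩ : ∃ π : E →L[ℝ] N, ∀ x : N, π x = x :=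
    Submodule.ClosedComplemented.of_finiteDimensional N
  have hinj : Function.Injective ((q.comp A).prod π : E →ₗ[ℝ] R × N) := by
    refine (injective_iff_map_eq_zero _).2 fun x hx => ?_
    have h1 : q (A x) = 0 := congrArg Prod.fst hx
    have h2 : π x = 0 := congrArg Prod.snd hx
    have h3 : A x = 0 := by
      have := hq ⟨A x, ⟨x, rfl⟩⟩
      rw [h1] at this
      exact (congrArg Subtype.val this).symm
    have := hπ ⟨x, h3⟩
    rw [h2] at this
    exact (congrArg Subtype.val this).symm
  have hdim : finrank ℝ E = finrank ℝ (R × N) := by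
    rw [finrank_prod, LinearMap.finrank_range_add_finrank_ker]
  let Φ' : E ≃L[ℝ] R × N :=
    (LinearMap.linearEquivOfInjective _ hinj hdim).toContinuousLinearEquiv
  let Φ : E → R × N := fun x => (q (g x), π x)
  have hΦ' : HasFDerivAt Φ (Φ' : E →L[ℝ] R × N) a := by
    have : HasFDerivAt Φ ((q.comp A).prod π) a :=
      (q.hasFDerivAt.comp a hAder).prodMk π.hasFDerivAt
    convert! this using 1
  have hΦ : ContDiffAt ℝ 1 Φ a :=
    (q.contDiff.contDiffAt.comp a (hgat a ha)).prodMk π.contDiff.contDiffAt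
  let e := hΦ.toOpenPartialHomeomorph Φ hΦ' one_ne_zero
  have hae : a ∈ e.source := hΦ.mem_toOpenPartialHomeomorph_source hΦ' one_ne_zero
  have hesymm : ContDiffAt ℝ 1 e.symm (Φ a) := hΦ.to_localInverse hΦ' one_ne_zero
  have hea : e.symm (Φ a) = a := e.left_inv hae
  have hev : ∀ᶠ y in 𝓝 (Φ a), ContDiffAt ℝ 1 e.symm y ∧ e.symm y ∈ U ∧ Φ (e.symm y) = y := by
    refine (hesymm.eventually (by simp)).and (.and ?_ ?_)
    · refine hesymm.continuousAt.eventually ?_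
      rw [hea]
      exact hU.mem_nhds ha
    · exact e.eventually_right_inverse (e.map_source hae)
  obtain ⟨ε, hε, hball⟩ := Metric.eventually_nhds_iff_ball.1 hev
  set H : R × N → E' := fun y => g (e.symm y)
  have hH : ∀ y ∈ Metric.ball (Φ a) ε, ContDiffAt ℝ 1 H y := fun y hy =>
    (hgat _ (hball y hy).2.1).comp y (hball y hy).1
  -- the derivative of `H` in the second variable lies in the kernel of `q`, which meets the range
  -- of the derivative of `g` trivially for dimension reasons
  have hder : ∀ y ∈ Metric.ball (Φ a) ε, ∀ w : N, fderiv ℝ H y (0, w) = 0 := by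
    intro y hy w
    have d1 : fderiv ℝ H y = (fderiv ℝ g (e.symm y)).comp (fderiv ℝ e.symm y) :=
      fderiv_comp y ((hgat _ (hball y hy).2.1).differentiableAt (by simp))
        ((hball y hy).1.differentiableAt (by simp))
    have d2 : q.comp (fderiv ℝ H y) = ContinuousLinearMap.fst ℝ R N := by
      have h1 : HasFDerivAt (fun y => q (H y)) (q.comp (fderiv ℝ H y)) y :=
        q.hasFDerivAt.comp y ((hH y hy).differentiableAt (by simp)).hasFDerivAt
      refine h1.unique (HasFDerivAt.congr_of_eventuallyEq hasFDerivAt_fst ?_)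
      filter_upwards [Metric.isOpen_ball.mem_nhds hy] with y' hy'
      exact congrArg Prod.fst (hball y' hy').2.2
    let S := LinearMap.range (fderiv ℝ g (e.symm y) : E →ₗ[ℝ] E')
    have hS : ∀ v, fderiv ℝ H y v ∈ S := fun v => ⟨fderiv ℝ e.symm y v, by rw [d1]; rfl⟩
    let ρ : S →ₗ[ℝ] R := (q : E' →ₗ[ℝ] R).comp S.subtype
    have hρ : Function.Injective ρ := by
      refine (LinearMap.injective_iff_surjective_of_finrank_eq_finrank ?_).2 fun u => ?_
      · rw [hr _ (hball y hy).2.1, hr a ha]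
      · exact ⟨⟨_, hS (u, 0)⟩, DFunLike.congr_fun d2 (u, 0)⟩
    have h0 : ρ ⟨_, hS (0, w)⟩ = ρ 0 := by
      rw [map_zero]; exact DFunLike.congr_fun d2 (0, w)
    exact congrArg Subtype.val (hρ h0)
  have hmem : ∀ {u v}, u ∈ Metric.ball (Φ a).1 ε → v ∈ Metric.ball (Φ a).2 ε →
      (u, v) ∈ Metric.ball (Φ a) ε := fun hu hv => by
    rw [← Prod.mk.eta (p := Φ a), ← ball_prod_same]; exact ⟨hu, hv⟩
  have hconst : ∀ u ∈ Metric.ball (Φ a).1 ε, ∀ v ∈ Metric.ball (Φ a).2 ε,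
      H (u, v) = H (u, (Φ a).2) := by
    intro u hu v hv
    have hd : ∀ v ∈ Metric.ball (Φ a).2 ε,
        HasFDerivAt (fun v => H (u, v)) (0 : N →L[ℝ] E') v := by
      intro v hv
      have h1 := ((hH _ (hmem hu hv)).differentiableAt (by simp)).hasFDerivAt.comp v
        (hasFDerivAt_prodMk_right u v)
      convert! h1 using 1
      ext w
      exact (hder _ (hmem hu hv) w).symm
    refine Metric.isOpen_ball.is_const_of_fderiv_eq_zero
      (convex_ball (Φ a).2 ε).isPreconnected
      (fun v hv => (hd v hv).differentiableAt.differentiableWithinAt)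
      (fun v hv => (hd v hv).fderiv) hv (Metric.mem_ball_self hε)
  refine ⟨{x | e.symm (Φ x) = x ∧ Φ x ∈ Metric.ball (Φ a) ε},
    (e.eventually_left_inverse hae).and
      (hΦ.continuousAt.eventually (Metric.ball_mem_nhds _ hε)), ?_⟩
  have hsub : g '' {x | e.symm (Φ x) = x ∧ Φ x ∈ Metric.ball (Φ a) ε} ⊆
      (fun u => H (u, (Φ a).2)) '' Metric.ball (Φ a).1 ε := by
    rintro _ ⟨x, ⟨hx1, hx2⟩, rfl⟩
    rw [← Prod.mk.eta (p := Φ a), ← ball_prod_same] at hx2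
    refine ⟨(Φ x).1, hx2.1, ?_⟩
    have := hconst _ hx2.1 _ hx2.2
    change H ((Φ x).1, _) = _
    rw [← this]
    exact congrArg g hx1
  have hC : ContDiffOn ℝ 1 (fun u => H (u, (Φ a).2)) (Metric.ball (Φ a).1 ε) := fun u hu =>
    ((hH _ (hmem hu (Metric.mem_ball_self hε))).comp u
      (contDiffAt_id.prodMk contDiffAt_const)).contDiffWithinAt
  calc dimH _ ≤ _ := dimH_mono hsub
    _ ≤ dimH (Metric.ball (Φ a).1 ε) := hC.dimH_image_le (convex_ball _ _) subset_rfl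
    _ ≤ dimH (Set.univ : Set R) := dimH_mono (Set.subset_univ _)
    _ = r := by rw [Real.dimH_univ_eq_finrank, hr a ha]

/-- A smooth map with surjective derivative at `a` has a smooth local section through `a`. -/
theorem ContDiffAt.exists_local_section [FiniteDimensional ℝ E'] {g : E → E'} {a : E}
    (hg : ContDiffAt ℝ ∞ g a)
    (hs : Function.Surjective (fderiv ℝ g a)) :
    ∃ σ : E' → E, ContDiffAt ℝ ∞ σ (g a) ∧ σ (g a) = a ∧ ∀ᶠ y in 𝓝 (g a), g (σ y) = y := by
  -- on the affine subspace `a + range C`, for a linear right inverse `C` of the derivative, `g` is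
  -- a local diffeomorphism
  obtain ⟨C, hC⟩ := (fderiv ℝ g a : E →ₗ[ℝ] E').exists_rightInverse_of_surjective
    (LinearMap.range_eq_top.2 hs)
  let C' : E' →L[ℝ] E := LinearMap.toContinuousLinearMap C
  let τ : E' → E := fun w => a + C' w
  have hτ : ContDiff ℝ ∞ τ := contDiff_const.add C'.contDiff
  have hτ0 : τ 0 = a := by simp [τ]
  have hg' : ContDiffAt ℝ ∞ g (τ 0) := by rwa [hτ0]
  have hh : ContDiffAt ℝ ∞ (g ∘ τ) 0 := hg'.comp 0 hτ.contDiffAt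
  have hh' : HasFDerivAt (g ∘ τ) (ContinuousLinearEquiv.refl ℝ E' : E' →L[ℝ] E') 0 := by
    have h1 := (hg'.differentiableAt (by simp)).hasFDerivAt.comp (0 : E')
      (C'.hasFDerivAt.const_add a)
    convert! h1 using 1
    ext w
    rw [hτ0]
    exact (LinearMap.congr_fun hC w).symm
  have h0 : (g ∘ τ) 0 = g a := by simp [hτ0]
  refine ⟨τ ∘ hh.localInverse hh' (by simp), ?_, ?_, ?_⟩
  · rw [← h0]
    exact hτ.contDiffAt.comp _ (hh.to_localInverse hh' (by simp))
  · have := hh.localInverse_apply_image hh' (by simp)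
    rw [h0] at this
    rw [Function.comp, this, hτ0]
  · rw [← h0]
    exact (hh.hasStrictFDerivAt' hh' (by simp)).eventually_right_inverse

end Calculus

/-! ### Fibres of submersions -/

section Submersion

open Topology

variable {E F : Type*} [NormedAddCommGroup E] [NormedSpace ℝ E]
  [NormedAddCommGroup F] [NormedSpace ℝ F]
  {N : Type*} [TopologicalSpace N] [ChartedSpace E N]
  {B : Type*} [TopologicalSpace B] [ChartedSpace F B]

theorem OpenPartialHomeomorph.mdifferentiable_of_mem_maximalAtlas {e : OpenPartialHomeomorph N E}
    (he : e ∈ IsManifold.maximalAtlas 𝓘(ℝ, E) ∞ N) : e.MDifferentiable 𝓘(ℝ, E) 𝓘(ℝ, E) :=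
  ⟨(contMDiffOn_of_mem_maximalAtlas he).mdifferentiableOn (by simp),
    (contMDiffOn_symm_of_mem_maximalAtlas he).mdifferentiableOn (by simp)⟩

namespace Manifold

variable {f : N → B}

/-- In suitable charts `e` and `c` a submersion is a surjective linear map `L`. -/
theorem IsSubmersion.exists_charts (hf : IsSubmersion 𝓘(ℝ, E) 𝓘(ℝ, F) ∞ f) (p : N) :
    ∃ (e : OpenPartialHomeomorph N E) (c : OpenPartialHomeomorph B F) (L : E →L[ℝ] F),
      e ∈ IsManifold.maximalAtlas 𝓘(ℝ, E) ∞ N ∧ c ∈ IsManifold.maximalAtlas 𝓘(ℝ, F) ∞ B ∧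
      p ∈ e.source ∧ Function.Surjective L ∧
      ∀ k ∈ e.source, f k ∈ c.source ∧ c (f k) = L (e k) := by
  have h := hf.isSubmersionAt p
  refine ⟨h.domChart, h.codChart, (ContinuousLinearMap.fst ℝ F h.complement).comp
    (h.equiv : E →L[ℝ] F × h.complement), h.domChart_mem_maximalAtlas,
    h.codChart_mem_maximalAtlas, h.mem_domChart_source,
    Prod.fst_surjective.comp h.equiv.surjective,
    fun k hk => ⟨h.source_subset_preimage_source hk, ?_⟩⟩
  have hk' : h.domChart k ∈ (h.domChart.extend 𝓘(ℝ, E)).target := by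
    simpa using h.domChart.map_source hk
  have := h.writtenInCharts hk'
  simpa [h.domChart.left_inv hk] using this

theorem IsSubmersion.mfderiv_comp_chart (hf : IsSubmersion 𝓘(ℝ, E) 𝓘(ℝ, F) ∞ f)
    {e : OpenPartialHomeomorph N E} {c : OpenPartialHomeomorph B F} {L : E →L[ℝ] F}
    (he : e ∈ IsManifold.maximalAtlas 𝓘(ℝ, E) ∞ N) (hc : c ∈ IsManifold.maximalAtlas 𝓘(ℝ, F) ∞ B)
    (h : ∀ k ∈ e.source, f k ∈ c.source ∧ c (f k) = L (e k)) {k : N} (hk : k ∈ e.source) (w : E) :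
    (mfderiv 𝓘(ℝ, F) 𝓘(ℝ, F) c (f k) : F →L[ℝ] F)
        ((mfderiv 𝓘(ℝ, E) 𝓘(ℝ, F) f k : E →L[ℝ] F) w) =
      L ((mfderiv 𝓘(ℝ, E) 𝓘(ℝ, E) e k : E →L[ℝ] E) w) := by
  have e1 : mfderiv 𝓘(ℝ, E) 𝓘(ℝ, F) (c ∘ f) k = _ := mfderiv_comp k
    ((OpenPartialHomeomorph.mdifferentiable_of_mem_maximalAtlas hc).mdifferentiableAt (h k hk).1)
    (hf.contMDiff.mdifferentiableAt (by simp))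
  have e2 : mfderiv 𝓘(ℝ, E) 𝓘(ℝ, F) (L ∘ e) k = _ := mfderiv_comp k
    L.mdifferentiableAt
    ((OpenPartialHomeomorph.mdifferentiable_of_mem_maximalAtlas he).mdifferentiableAt hk)
  have e3 : mfderiv 𝓘(ℝ, E) 𝓘(ℝ, F) (c ∘ f) k = mfderiv 𝓘(ℝ, E) 𝓘(ℝ, F) (L ∘ e) k := by
    refine Filter.EventuallyEq.mfderiv_eq ?_
    filter_upwards [e.open_source.mem_nhds hk] with k' hk'
    exact (h k' hk').2
  rw [e1, e2, L.mfderiv_eq] at e3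
  exact DFunLike.congr_fun e3 w

theorem IsSubmersion.mfderiv_surjective (hf : IsSubmersion 𝓘(ℝ, E) 𝓘(ℝ, F) ∞ f) (k : N) :
    Function.Surjective (mfderiv 𝓘(ℝ, E) 𝓘(ℝ, F) f k : E →L[ℝ] F) := by
  obtain ⟨e, c, L, he, hc, hk, hL, h⟩ := hf.exists_charts k
  intro w
  have he' := OpenPartialHomeomorph.mdifferentiable_of_mem_maximalAtlas he
  have hc' := OpenPartialHomeomorph.mdifferentiable_of_mem_maximalAtlas hc
  obtain ⟨v, hv⟩ := hL ((mfderiv 𝓘(ℝ, F) 𝓘(ℝ, F) c (f k) : F →L[ℝ] F) w)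
  obtain ⟨u, rfl⟩ := he'.mfderiv_surjective hk v
  exact ⟨u, hc'.mfderiv_injective (h k hk).1 ((hf.mfderiv_comp_chart he hc h hk u).trans hv)⟩

/-- The fibre of a submersion `f` through a point `p` is parametrized near `p` by an open set of a
linear subspace of the model space, in such a way that the parametrization is an immersion with
image tangent to `ker df`. -/
theorem IsSubmersion.exists_fibre_parametrization (hf : IsSubmersion 𝓘(ℝ, E) 𝓘(ℝ, F) ∞ f) (p : N) :
    ∃ (V : Submodule ℝ E) (U : Set V) (ι : V → N), IsOpen U ∧ 0 ∈ U ∧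
      ContMDiffOn 𝓘(ℝ, V) 𝓘(ℝ, E) ∞ ι U ∧ ι 0 = p ∧ (∀ v ∈ U, f (ι v) = f p) ∧
      (∀ W ∈ 𝓝 (0 : V), ι '' W ∈ 𝓝[f ⁻¹' {f p}] p) ∧
      ∀ v ∈ U, (mfderiv 𝓘(ℝ, E) 𝓘(ℝ, F) f (ι v) : E →L[ℝ] F).ker =
        (mfderiv 𝓘(ℝ, V) 𝓘(ℝ, E) ι v : V →L[ℝ] E).range := by
  -- in charts in which `f` is a linear map `L`, the fibre is a translate of `ker L`
  obtain ⟨e, c, L, he, hc, hp, -, h⟩ := hf.exists_charts p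
  have he' := OpenPartialHomeomorph.mdifferentiable_of_mem_maximalAtlas he
  let V : Submodule ℝ E := LinearMap.ker (L : E →ₗ[ℝ] F)
  let τ : V → E := fun v => e p + V.subtypeL v
  have hτ : ContDiff ℝ ∞ τ := contDiff_const.add V.subtypeL.contDiff
  have hτm : ContMDiff 𝓘(ℝ, V) 𝓘(ℝ, E) ∞ τ := hτ.contMDiff
  have hUo : IsOpen (τ ⁻¹' e.target) := e.open_target.preimage hτ.continuous
  have hι : ContMDiffOn 𝓘(ℝ, V) 𝓘(ℝ, E) ∞ (e.symm ∘ τ) (τ ⁻¹' e.target) :=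
    (contMDiffOn_symm_of_mem_maximalAtlas he).comp hτm.contMDiffOn subset_rfl
  have hfib : ∀ v ∈ τ ⁻¹' e.target, f (e.symm (τ v)) = f p := by
    intro v hv
    have h1 := h _ (e.map_target hv)
    have h2 := h p hp
    refine c.injOn h1.1 h2.1 ?_
    rw [h1.2, h2.2, e.right_inv hv, map_add]
    have : L (V.subtypeL v) = 0 := v.2
    rw [this, add_zero]
  refine ⟨V, τ ⁻¹' e.target, e.symm ∘ τ, hUo, ?_, hι, ?_, hfib, fun W hW => ?_, fun v hv => ?_⟩
  · simpa [τ] using e.map_source hp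
  · simp [τ, e.left_inv hp]
  · obtain ⟨W', hW', hsub⟩ := mem_nhds_subtype _ _ _ |>.1 hW
    have hcont : ContinuousAt (fun q => e q - e p) p :=
      (e.continuousAt hp).sub continuousAt_const
    have h0 : (fun q => e q - e p) ⁻¹' W' ∈ 𝓝 p := hcont (by simpa using hW')
    filter_upwards [self_mem_nhdsWithin, nhdsWithin_le_nhds h0,
      nhdsWithin_le_nhds (e.open_source.mem_nhds hp)] with q hq hqW hqs
    have hV : e q - e p ∈ V := by
      change L (e q - e p) = 0
      rw [map_sub, ← (h q hqs).2, ← (h p hp).2, show f q = f p from hq, sub_self]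
    refine ⟨⟨e q - e p, hV⟩, hsub hqW, ?_⟩
    simp [τ, e.left_inv hqs]
  · have hk := e.map_target hv
    have hιv : MDifferentiableAt 𝓘(ℝ, V) 𝓘(ℝ, E) (e.symm ∘ τ) v :=
      (hι.contMDiffAt (hUo.mem_nhds hv)).mdifferentiableAt (by simp)
    have hfk : MDifferentiableAt 𝓘(ℝ, E) 𝓘(ℝ, F) f (e.symm (τ v)) :=
      hf.contMDiff.mdifferentiableAt (by simp)
    have hder : (mfderiv 𝓘(ℝ, V) 𝓘(ℝ, E) (e.symm ∘ τ) v : V →L[ℝ] E) =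
        (mfderiv 𝓘(ℝ, E) 𝓘(ℝ, E) e.symm (τ v) : E →L[ℝ] E).comp V.subtypeL := by
      have h1 : mfderiv 𝓘(ℝ, V) 𝓘(ℝ, E) (e.symm ∘ τ) v = _ := mfderiv_comp v
        (he'.mdifferentiableAt_symm hv) (hτm.mdifferentiableAt (by simp))
      have h2 : mfderiv 𝓘(ℝ, V) 𝓘(ℝ, E) τ v = V.subtypeL := by
        rw [mfderiv_eq_fderiv]
        exact (V.subtypeL.hasFDerivAt.const_add (e p)).fderiv
      rw [h1, h2]
      rfl
    apply le_antisymm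
    · intro w hw
      have hw' : (mfderiv 𝓘(ℝ, E) 𝓘(ℝ, F) f (e.symm (τ v)) : E →L[ℝ] F) w = 0 := hw
      have h1 := hf.mfderiv_comp_chart he hc h hk w
      rw [hw', map_zero] at h1
      refine ⟨⟨(mfderiv 𝓘(ℝ, E) 𝓘(ℝ, E) e (e.symm (τ v)) : E →L[ℝ] E) w, h1.symm⟩, ?_⟩
      have h2 := DFunLike.congr_fun (he'.symm_comp_deriv hk) w
      rw [e.right_inv hv] at h2
      exact (DFunLike.congr_fun hder _).trans h2
    · rintro _ ⟨u, rfl⟩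
      have h1 : mfderiv 𝓘(ℝ, V) 𝓘(ℝ, F) (f ∘ (e.symm ∘ τ)) v = _ := mfderiv_comp v hfk hιv
      have h2 : mfderiv 𝓘(ℝ, V) 𝓘(ℝ, F) (f ∘ (e.symm ∘ τ)) v = 0 := by
        refine ((hasMFDerivAt_const (f p) v).congr_of_eventuallyEq ?_).mfderiv
        filter_upwards [hUo.mem_nhds hv] with v' hv' using hfib v' hv'
      rw [h2] at h1
      exact (DFunLike.congr_fun h1 u).symm

/-- Let `φ` be a map that is smooth along the fibre of `f` through `k`, sends this fibre into a
fibre of `f`, and preserves `h` on it. Then `dh (ker df)` does not decrease from `k` to `φ k`. -/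
theorem IsSubmersion.map_ker_mfderiv_le (hf : IsSubmersion 𝓘(ℝ, E) 𝓘(ℝ, F) ∞ f)
    {h : N → B} (hh : ContMDiff 𝓘(ℝ, E) 𝓘(ℝ, F) ∞ h) {φ : N → N} {k : N}
    (hφ : ContMDiffWithinAt 𝓘(ℝ, E) 𝓘(ℝ, E) ∞ φ (f ⁻¹' {f k}) k)
    (h1 : ∀ x, f x = f k → f (φ x) = f (φ k)) (h2 : ∀ x, f x = f k → h (φ x) = h x) :
    (mfderiv 𝓘(ℝ, E) 𝓘(ℝ, F) f k : E →L[ℝ] F).ker.map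
        (mfderiv 𝓘(ℝ, E) 𝓘(ℝ, F) h k : E →L[ℝ] F).toLinearMap ≤
      (mfderiv 𝓘(ℝ, E) 𝓘(ℝ, F) f (φ k) : E →L[ℝ] F).ker.map
        (mfderiv 𝓘(ℝ, E) 𝓘(ℝ, F) h (φ k) : E →L[ℝ] F).toLinearMap := by
  obtain ⟨V, U, ι, hU, h0, hι, rfl, hfib, -, hker⟩ := hf.exists_fibre_parametrization k
  rw [hker 0 h0]
  rintro _ ⟨_, ⟨v, rfl⟩, rfl⟩
  have hι0 := hι.contMDiffAt (hU.mem_nhds h0)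
  have hφι : MDifferentiableAt 𝓘(ℝ, V) 𝓘(ℝ, E) (φ ∘ ι) 0 := by
    have : ContMDiffWithinAt 𝓘(ℝ, V) 𝓘(ℝ, E) ∞ (φ ∘ ι) U 0 :=
      hφ.comp 0 (hι 0 h0) fun v hv => hfib v hv
    exact (this.contMDiffAt (hU.mem_nhds h0)).mdifferentiableAt (by simp)
  have hιd := hι0.mdifferentiableAt (by simp)
  have d1 : mfderiv 𝓘(ℝ, V) 𝓘(ℝ, F) (f ∘ (φ ∘ ι)) 0 = _ := mfderiv_comp 0
    (hf.contMDiff.mdifferentiableAt (by simp)) hφι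
  have d2 : mfderiv 𝓘(ℝ, V) 𝓘(ℝ, F) (h ∘ (φ ∘ ι)) 0 = _ := mfderiv_comp 0
    (hh.mdifferentiableAt (by simp)) hφι
  have d3 : mfderiv 𝓘(ℝ, V) 𝓘(ℝ, F) (h ∘ ι) 0 = _ := mfderiv_comp 0
    (hh.mdifferentiableAt (by simp)) hιd
  have e1 : mfderiv 𝓘(ℝ, V) 𝓘(ℝ, F) (f ∘ (φ ∘ ι)) 0 = 0 := by
    refine ((hasMFDerivAt_const (f (φ (ι 0))) (0 : V)).congr_of_eventuallyEq ?_).mfderiv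
    filter_upwards [hU.mem_nhds h0] with v hv using h1 _ (hfib v hv)
  have e2 : (mfderiv 𝓘(ℝ, V) 𝓘(ℝ, F) (h ∘ (φ ∘ ι)) 0 : V →L[ℝ] F) =
      (mfderiv 𝓘(ℝ, V) 𝓘(ℝ, F) (h ∘ ι) 0 : V →L[ℝ] F) := by
    refine Filter.EventuallyEq.mfderiv_eq ?_
    filter_upwards [hU.mem_nhds h0] with v hv using h2 _ (hfib v hv)
  refine ⟨(mfderiv 𝓘(ℝ, V) 𝓘(ℝ, E) (φ ∘ ι) 0 : V →L[ℝ] E) v, ?_, ?_⟩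
  · rw [e1] at d1
    exact (DFunLike.congr_fun d1 v).symm
  · exact (DFunLike.congr_fun d2 v).symm.trans
      ((DFunLike.congr_fun e2 v).trans (DFunLike.congr_fun d3 v))

end Manifold

end Submersion

/-! ### The rank of the target map on source fibres -/

/-- If `S` and `T` are surjective, both sides are `dim ker S - dim (ker S ∩ ker T)`, as
`ker S` and `ker T` have the same dimension. -/
theorem LinearMap.finrank_map_ker_comm {V W : Type*} [AddCommGroup V] [Module ℝ V]
    [FiniteDimensional ℝ V] [AddCommGroup W] [Module ℝ W] {S T : V →ₗ[ℝ] W}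
    (hS : Function.Surjective S) (hT : Function.Surjective T) :
    Module.finrank ℝ (S.ker.map T) = Module.finrank ℝ (T.ker.map S) := by
  have key : ∀ A B : V →ₗ[ℝ] W, Module.finrank ℝ (A.ker.map B) +
      Module.finrank ℝ (A.ker ⊓ B.ker : Submodule ℝ V) = Module.finrank ℝ A.ker := by
    intro A B
    have h := LinearMap.finrank_range_add_finrank_ker (B.comp A.ker.subtype)
    rwa [LinearMap.range_comp, Submodule.range_subtype, LinearMap.ker_comp,
      ← Submodule.finrank_map_subtype_eq, Submodule.map_comap_subtype] at h
  have h1 := key S T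
  have h2 := key T S
  have h3 := LinearMap.finrank_range_add_finrank_ker S
  have h4 := LinearMap.finrank_range_add_finrank_ker T
  rw [LinearMap.range_eq_top.2 hS] at h3
  rw [LinearMap.range_eq_top.2 hT] at h4
  rw [inf_comm] at h2
  omega

namespace LieGroupoid

open Topology Module

variable {EM : Type uEM} [NormedAddCommGroup EM] [NormedSpace ℝ EM]
  {EG : Type uEG} [NormedAddCommGroup EG] [NormedSpace ℝ EG]
  {M : Type uM} [TopologicalSpace M] [ChartedSpace EM M]
  {G : Type uG} [TopologicalSpace G] [ChartedSpace EG G]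
  (𝒢 : LieGroupoid EM EG M G)

/-- The derivative of the source map, as a map between the model spaces. -/
noncomputable def dsrc (g : G) : EG →L[ℝ] EM := mfderiv 𝓘(ℝ, EG) 𝓘(ℝ, EM) 𝒢.src g

/-- The derivative of the target map, as a map between the model spaces. -/
noncomputable def dtgt (g : G) : EG →L[ℝ] EM := mfderiv 𝓘(ℝ, EG) 𝓘(ℝ, EM) 𝒢.tgt g

/-- The image under `d tgt` of the tangent space at `g` to the source fibre. Geometrically, this is
the tangent space to the orbit at `tgt g`. -/
noncomputable def orbitTangent (g : G) : Submodule ℝ EM :=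
  (𝒢.dsrc g).ker.map (𝒢.dtgt g).toLinearMap

variable {𝒢}

theorem mul_inv_cancel_right {a b : G} (h : 𝒢.src a = 𝒢.tgt b) :
    𝒢.mul (𝒢.mul a b) (𝒢.inv b) = a := by
  rw [𝒢.mul_assoc _ _ _ h (𝒢.tgt_inv b).symm, 𝒢.mul_inv, ← h, 𝒢.mul_unit]

theorem contMDiffWithinAt_mul_right {g l : G} (h : 𝒢.src g = 𝒢.tgt l) :
    ContMDiffWithinAt 𝓘(ℝ, EG) 𝓘(ℝ, EG) ∞ (fun x => 𝒢.mul x l) (𝒢.src ⁻¹' {𝒢.src g}) g :=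
  ContMDiffWithinAt.comp (f := fun x => (x, l)) g (𝒢.contMDiffOn_mul (g, l) h)
    (contMDiffWithinAt_id.prodMk contMDiffWithinAt_const) fun _ hx => Eq.trans hx h

theorem contMDiffWithinAt_mul_left {g l : G} (h : 𝒢.src l = 𝒢.tgt g) :
    ContMDiffWithinAt 𝓘(ℝ, EG) 𝓘(ℝ, EG) ∞ (fun x => 𝒢.mul l x) (𝒢.tgt ⁻¹' {𝒢.tgt g}) g :=
  ContMDiffWithinAt.comp (f := fun x => (l, x)) g (𝒢.contMDiffOn_mul (l, g) h)
    (contMDiffWithinAt_const.prodMk contMDiffWithinAt_id) fun _ hx => h.trans (Eq.symm hx)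

theorem orbitTangent_le_mul_right {g l : G} (h : 𝒢.src g = 𝒢.tgt l) :
    𝒢.orbitTangent g ≤ 𝒢.orbitTangent (𝒢.mul g l) :=
  𝒢.isSubmersion_src.map_ker_mfderiv_le (φ := fun x => 𝒢.mul x l) 𝒢.isSubmersion_tgt.contMDiff
    (contMDiffWithinAt_mul_right h)
    (fun x hx => (𝒢.src_mul x l (hx.trans h)).trans (𝒢.src_mul g l h).symm)
    (fun _ hx => 𝒢.tgt_mul _ _ (hx.trans h))

theorem orbitTangent_mul_right {g l : G} (h : 𝒢.src g = 𝒢.tgt l) :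
    𝒢.orbitTangent (𝒢.mul g l) = 𝒢.orbitTangent g := by
  refine le_antisymm ?_ (orbitTangent_le_mul_right h)
  have h' : 𝒢.src (𝒢.mul g l) = 𝒢.tgt (𝒢.inv l) := by rw [𝒢.src_mul _ _ h, 𝒢.tgt_inv]
  simpa only [mul_inv_cancel_right h] using orbitTangent_le_mul_right h'

theorem map_ker_dtgt_le_mul_left {g l : G} (h : 𝒢.src l = 𝒢.tgt g) :
    (𝒢.dtgt g).ker.map (𝒢.dsrc g).toLinearMap ≤
      (𝒢.dtgt (𝒢.mul l g)).ker.map (𝒢.dsrc (𝒢.mul l g)).toLinearMap :=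
  𝒢.isSubmersion_tgt.map_ker_mfderiv_le (φ := fun x => 𝒢.mul l x) 𝒢.isSubmersion_src.contMDiff
    (contMDiffWithinAt_mul_left h)
    (fun x hx => (𝒢.tgt_mul l x (h.trans hx.symm)).trans (𝒢.tgt_mul l g h).symm)
    (fun _ hx => 𝒢.src_mul _ _ (h.trans hx.symm))

theorem map_ker_dtgt_mul_left {g l : G} (h : 𝒢.src l = 𝒢.tgt g) :
    (𝒢.dtgt (𝒢.mul l g)).ker.map (𝒢.dsrc (𝒢.mul l g)).toLinearMap =
      (𝒢.dtgt g).ker.map (𝒢.dsrc g).toLinearMap := by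
  refine le_antisymm ?_ (map_ker_dtgt_le_mul_left h)
  have h' : 𝒢.src (𝒢.inv l) = 𝒢.tgt (𝒢.mul l g) := by rw [𝒢.tgt_mul _ _ h, 𝒢.src_inv]
  simpa only [inv_mul_cancel_left h] using map_ker_dtgt_le_mul_left h'

/-- Right translations preserve `dt (ker ds)`, left translations preserve `ds (ker dt)`, and the
two spaces have the same dimension. As any two arrows of a transitive groupoid differ by a left
and a right translation, the dimension is constant. -/
theorem IsTransitive.finrank_orbitTangent_eq [FiniteDimensional ℝ EG] (h𝒢 : 𝒢.IsTransitive)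
    (g g' : G) : finrank ℝ (𝒢.orbitTangent g) = finrank ℝ (𝒢.orbitTangent g') := by
  have hcomm : ∀ g, finrank ℝ (𝒢.orbitTangent g) =
      finrank ℝ ((𝒢.dtgt g).ker.map (𝒢.dsrc g).toLinearMap) := fun g =>
    LinearMap.finrank_map_ker_comm (𝒢.isSubmersion_src.mfderiv_surjective g)
      (𝒢.isSubmersion_tgt.mfderiv_surjective g)
  obtain ⟨l, hl, hl'⟩ := h𝒢 (𝒢.tgt g) (𝒢.tgt g')
  have ht : 𝒢.tgt (𝒢.mul l g) = 𝒢.tgt g' := by rw [𝒢.tgt_mul _ _ hl, hl']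
  have hg' : 𝒢.mul (𝒢.mul l g) (𝒢.mul (𝒢.inv (𝒢.mul l g)) g') = g' := mul_inv_cancel_left ht
  have h1 : 𝒢.orbitTangent g' = 𝒢.orbitTangent (𝒢.mul l g) := by
    conv_lhs => rw [← hg']
    refine orbitTangent_mul_right ?_
    rw [𝒢.tgt_mul _ _ ((𝒢.src_inv _).trans ht), 𝒢.tgt_inv]
  rw [h1, hcomm, hcomm, map_ker_dtgt_mul_left hl]

/-- In a chart `c` of the base, the range of the derivative of the target map along a
parametrization `ι` of a source fibre is `orbitTangent`, up to the derivative of `c`. -/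
theorem exists_range_fderiv_chart_tgt {c : OpenPartialHomeomorph M EM}
    (hc : c ∈ IsManifold.maximalAtlas 𝓘(ℝ, EM) ∞ M) {V : Submodule ℝ EG} {ι : V → G} {v : V}
    (hι : ContMDiffAt 𝓘(ℝ, V) 𝓘(ℝ, EG) ∞ ι v) (hv : 𝒢.tgt (ι v) ∈ c.source)
    (hker : (𝒢.dsrc (ι v)).ker = (mfderiv 𝓘(ℝ, V) 𝓘(ℝ, EG) ι v : V →L[ℝ] EG).range) :
    ∃ D : EM →L[ℝ] EM, Function.Bijective D ∧
      (fderiv ℝ (fun v => c (𝒢.tgt (ι v))) v).range =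
        (𝒢.orbitTangent (ι v)).map D.toLinearMap := by
  have hcd := OpenPartialHomeomorph.mdifferentiable_of_mem_maximalAtlas hc
  refine ⟨mfderiv 𝓘(ℝ, EM) 𝓘(ℝ, EM) c (𝒢.tgt (ι v)), hcd.mfderiv_bijective hv, ?_⟩
  have htgt : MDifferentiableAt 𝓘(ℝ, EG) 𝓘(ℝ, EM) 𝒢.tgt (ι v) :=
    𝒢.isSubmersion_tgt.contMDiff.mdifferentiableAt (by simp)
  have hιd := hι.mdifferentiableAt (by simp)
  have d1 : mfderiv 𝓘(ℝ, V) 𝓘(ℝ, EM) (c ∘ (𝒢.tgt ∘ ι)) v = _ := mfderiv_comp v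
    (hcd.mdifferentiableAt hv) (htgt.comp v hιd)
  have d2 : mfderiv 𝓘(ℝ, V) 𝓘(ℝ, EM) (𝒢.tgt ∘ ι) v = _ := mfderiv_comp v htgt hιd
  have d3 : fderiv ℝ (fun v => c (𝒢.tgt (ι v))) v =
      (mfderiv 𝓘(ℝ, EM) 𝓘(ℝ, EM) c (𝒢.tgt (ι v)) : EM →L[ℝ] EM).comp
        ((𝒢.dtgt (ι v)).comp (mfderiv 𝓘(ℝ, V) 𝓘(ℝ, EG) ι v : V →L[ℝ] EG)) := by
    rw [← mfderiv_eq_fderiv]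
    rw [d2] at d1
    exact d1
  rw [d3, orbitTangent, hker]
  ext w
  constructor
  · rintro ⟨u, rfl⟩
    exact ⟨_, ⟨_, ⟨u, rfl⟩, rfl⟩, rfl⟩
  · rintro ⟨_, ⟨_, ⟨u, rfl⟩, rfl⟩, rfl⟩
    exact ⟨u, rfl⟩

/-- The target map of a transitive groupoid with second countable arrow space is a submersion on
every source fibre: it has constant rank `r` on the source fibre at `z`, so in a chart of the base
its image is a countable union of sets of Hausdorff dimension at most `r`. As the image is
everything, `r` is the dimension of the base. -/
theorem IsTransitive.orbitTangent_eq_top [FiniteDimensional ℝ EM] [FiniteDimensional ℝ EG]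
    [IsManifold 𝓘(ℝ, EM) ∞ M] [SecondCountableTopology G] (h𝒢 : 𝒢.IsTransitive) (g : G) :
    𝒢.orbitTangent g = ⊤ := by
  let z := 𝒢.src g
  let c := chartAt EM z
  have hc : c ∈ IsManifold.maximalAtlas 𝓘(ℝ, EM) ∞ M := IsManifold.chart_mem_maximalAtlas z
  let Q : Set G := {q | 𝒢.src q = z ∧ 𝒢.tgt q ∈ c.source}
  set r := finrank ℝ (𝒢.orbitTangent g) with hr
  have hloc : ∀ q ∈ Q, ∃ W ∈ 𝓝[Q] q, dimH ((fun q => c (𝒢.tgt q)) '' W) ≤ r := by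
    rintro q ⟨hqz, hqc⟩
    obtain ⟨V, U, ι, hU, h0, hι, rfl, hfib, hnhds, hker⟩ :=
      𝒢.isSubmersion_src.exists_fibre_parametrization q
    have htι : ContMDiffOn 𝓘(ℝ, V) 𝓘(ℝ, EM) ∞ (𝒢.tgt ∘ ι) U :=
      𝒢.isSubmersion_tgt.contMDiff.comp_contMDiffOn hι
    have hU' : IsOpen (U ∩ (𝒢.tgt ∘ ι) ⁻¹' c.source) :=
      htι.continuousOn.isOpen_inter_preimage hU c.open_source
    have hg : ContDiffOn ℝ ∞ (fun v => c (𝒢.tgt (ι v))) (U ∩ (𝒢.tgt ∘ ι) ⁻¹' c.source) :=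
      ((contMDiffOn_of_mem_maximalAtlas hc).comp
        (htι.mono Set.inter_subset_left) fun v hv => hv.2).contDiffOn
    have hrank : ∀ v ∈ U ∩ (𝒢.tgt ∘ ι) ⁻¹' c.source,
        finrank ℝ (fderiv ℝ (fun v => c (𝒢.tgt (ι v))) v).range = r := by
      intro v hv
      obtain ⟨D, hD, h1⟩ := exists_range_fderiv_chart_tgt hc
        (hι.contMDiffAt (hU.mem_nhds hv.1)) hv.2 (hker v hv.1)
      rw [h1, hr, ← h𝒢.finrank_orbitTangent_eq (ι v) g]
      exact (Submodule.equivMapOfInjective _ hD.injective _).finrank_eq.symm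
    obtain ⟨N, hN, hdim⟩ := exists_mem_nhds_dimH_image_le_of_constant_rank hU'
      (hg.of_le (by simp)) hrank ⟨h0, hqc⟩
    refine ⟨ι '' N, nhdsWithin_mono _ (fun x hx => hx.1.trans hqz.symm) (hnhds N hN), ?_⟩
    rwa [← Set.image_comp]
  -- the source fibre is Lindelöf, as the arrow space is second countable
  choose! W hW hWdim using hloc
  obtain ⟨S, hSQ, hSc, hcover⟩ := TopologicalSpace.countable_cover_nhdsWithin hW
  have hsub : c.target ⊆ ⋃ q ∈ S, (fun q => c (𝒢.tgt q)) '' W q := by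
    intro y hy
    obtain ⟨k, hk, hk'⟩ := h𝒢 z (c.symm y)
    have hkQ : k ∈ Q := ⟨hk, by rw [hk']; exact c.map_target hy⟩
    obtain ⟨q, hq, hkq⟩ := Set.mem_iUnion₂.1 (hcover hkQ)
    exact Set.mem_iUnion₂.2 ⟨q, hq, k, hkq, by simp only [hk', c.right_inv hy]⟩
  have hle : (finrank ℝ EM : ENNReal) ≤ r := by
    rw [← Real.dimH_of_mem_nhds
      (c.open_target.mem_nhds (c.map_source (mem_chart_source EM z)))]
    refine (dimH_mono hsub).trans ?_
    rw [dimH_bUnion hSc]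
    exact iSup₂_le fun q hq => hWdim q (hSQ hq)
  exact Submodule.eq_top_of_finrank_eq
    (le_antisymm (Submodule.finrank_le _) (by exact_mod_cast hle))

/-- The target map of a transitive groupoid with second countable arrow space has smooth local
sections with values in any given source fibre. -/
theorem IsTransitive.exists_local_section [FiniteDimensional ℝ EM] [FiniteDimensional ℝ EG]
    [IsManifold 𝓘(ℝ, EM) ∞ M] [SecondCountableTopology G] (h𝒢 : 𝒢.IsTransitive) (z m : M) :
    ∃ σ : M → G, ContMDiffAt 𝓘(ℝ, EM) 𝓘(ℝ, EG) ∞ σ m ∧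
      ∀ᶠ m' in 𝓝 m, 𝒢.src (σ m') = z ∧ 𝒢.tgt (σ m') = m' := by
  obtain ⟨g, rfl, rfl⟩ := h𝒢 z m
  obtain ⟨V, U, ι, hU, h0, hι, hιg, hfib, -, hker⟩ :=
    𝒢.isSubmersion_src.exists_fibre_parametrization g
  let c := chartAt EM (𝒢.tgt g)
  have hc : c ∈ IsManifold.maximalAtlas 𝓘(ℝ, EM) ∞ M := IsManifold.chart_mem_maximalAtlas _
  have hgc : 𝒢.tgt g ∈ c.source := mem_chart_source EM _
  have hι0 := hι.contMDiffAt (hU.mem_nhds h0)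
  have htι : ContMDiffAt 𝓘(ℝ, V) 𝓘(ℝ, EM) ∞ (𝒢.tgt ∘ ι) 0 :=
    𝒢.isSubmersion_tgt.contMDiff.contMDiffAt.comp 0 hι0
  have hgc0 : 𝒢.tgt (ι 0) ∈ c.source := by rwa [hιg]
  have hG : ContDiffAt ℝ ∞ (fun v => c (𝒢.tgt (ι v))) 0 :=
    ((contMDiffAt_of_mem_maximalAtlas hc hgc0).comp 0 htι).contDiffAt
  have hsurj : Function.Surjective (fderiv ℝ (fun v => c (𝒢.tgt (ι v))) 0) := by
    obtain ⟨D, hD, h1⟩ := exists_range_fderiv_chart_tgt hc hι0 hgc0 (hker 0 h0)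
    refine LinearMap.range_eq_top.1 (h1.trans ?_)
    rw [h𝒢.orbitTangent_eq_top, Submodule.map_top]
    exact LinearMap.range_eq_top.2 hD.surjective
  obtain ⟨τ, hτ, hτ0, hτsec⟩ := hG.exists_local_section hsurj
  simp only [hιg] at hτ hτ0 hτsec
  have hcg := contMDiffAt_of_mem_maximalAtlas (I := 𝓘(ℝ, EM)) (n := ∞) hc hgc
  have hτc : ContMDiffAt 𝓘(ℝ, EM) 𝓘(ℝ, V) ∞ (τ ∘ c) (𝒢.tgt g) :=
    hτ.contMDiffAt.comp _ hcg
  have hτc0 : (τ ∘ c) (𝒢.tgt g) = 0 := hτ0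
  refine ⟨ι ∘ (τ ∘ c), ?_, ?_⟩
  · refine ContMDiffAt.comp _ ?_ hτc
    rwa [hτc0]
  · have hcont : Filter.Tendsto (τ ∘ c) (𝓝 (𝒢.tgt g)) (𝓝 0) := by
      have := hτc.continuousAt.tendsto
      rwa [hτc0] at this
    filter_upwards [hcont.eventually (hU.mem_nhds h0), c.open_source.mem_nhds hgc,
      hcg.continuousAt.eventually hτsec,
      hcont.eventually (htι.continuousAt.eventually (c.open_source.mem_nhds hgc0))]
      with m' h1 h2 h3 h4
    exact ⟨hfib _ h1, c.injOn h4 h2 h3⟩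

end LieGroupoid

namespace LieGroupoid

open Topology

variable {EM : Type uEM} [NormedAddCommGroup EM] [NormedSpace ℝ EM]
  {EG : Type uEG} [NormedAddCommGroup EG] [NormedSpace ℝ EG]
  {EK : Type uEK} [NormedAddCommGroup EK] [NormedSpace ℝ EK]
  {M : Type uM} [TopologicalSpace M] [ChartedSpace EM M]
  {G : Type uG} [TopologicalSpace G] [ChartedSpace EG G]
  {K : Type uK} [TopologicalSpace K] [ChartedSpace EK K]
  {𝒢 : LieGroupoid EM EG M G}

/-! ### Conjugation in terms of arrows with a common target -/

theorem quot_mem {Z : Set M} {p : ℕ} {c : Fin (p + 1) → G}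
    (hc : ∀ i j, 𝒢.tgt (c i) = 𝒢.tgt (c j)) (hZ : ∀ i, 𝒢.src (c i) ∈ Z) :
    𝒢.quot c ∈ 𝒢.nerve Z p := by
  refine ⟨hZ, fun j => ?_⟩
  have h : 𝒢.src (𝒢.inv (c j.castSucc)) = 𝒢.tgt (c j.succ) := by rw [𝒢.src_inv]; exact hc _ _
  simp only [quot]
  rw [𝒢.tgt_mul _ _ h, 𝒢.src_mul _ _ h, 𝒢.tgt_inv]
  exact ⟨rfl, rfl⟩

/-- Conjugation by `k` replaces `c_i` by `c_i k_i`. -/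
theorem conj_quot {p : ℕ} {c k : Fin (p + 1) → G} (hc : ∀ i j, 𝒢.tgt (c i) = 𝒢.tgt (c j))
    (hk : ∀ i, 𝒢.tgt (k i) = 𝒢.src (c i)) :
    𝒢.conj k (𝒢.quot c) = 𝒢.quot (fun i => 𝒢.mul (c i) (k i)) := by
  refine Prod.ext (funext fun i => ?_) (funext fun j => ?_)
  · exact (𝒢.src_mul _ _ (hk i).symm).symm
  · simp only [conj, quot]
    have h1 : 𝒢.src (𝒢.inv (c j.castSucc)) = 𝒢.tgt (c j.succ) := by
      rw [𝒢.src_inv]; exact hc _ _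
    have h2 : 𝒢.src (𝒢.inv (k j.castSucc)) = 𝒢.tgt (𝒢.mul (𝒢.inv (c j.castSucc)) (c j.succ)) := by
      rw [𝒢.tgt_mul _ _ h1, 𝒢.src_inv, 𝒢.tgt_inv, hk]
    have h3 := (hk j.succ).symm
    rw [inv_mul_rev (hk j.castSucc).symm (by rw [𝒢.tgt_mul _ _ h3]; exact hc _ _),
      ← 𝒢.mul_assoc _ _ _ h1 h3, 𝒢.mul_assoc _ _ _ h2 (by rw [𝒢.src_mul _ _ h1, h3])]

theorem tgt_mul_congr {ι : Type*} {c k : ι → G} (hc : ∀ i j, 𝒢.tgt (c i) = 𝒢.tgt (c j))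
    (hk : ∀ i, 𝒢.tgt (k i) = 𝒢.src (c i)) (i j : ι) :
    𝒢.tgt (𝒢.mul (c i) (k i)) = 𝒢.tgt (𝒢.mul (c j) (k j)) := by
  rw [𝒢.tgt_mul _ _ (hk i).symm, 𝒢.tgt_mul _ _ (hk j).symm]
  exact hc i j

theorem face_conj {Z : Set M} {p : ℕ} (i : Fin (p + 2)) {k : Fin (p + 2) → G}
    {x : Tuples M G (p + 1)} (hx : x ∈ 𝒢.nerve Z (p + 1)) (hk : ∀ i, 𝒢.tgt (k i) = x.1 i) :
    𝒢.face i (𝒢.conj k x) = 𝒢.conj (k ∘ i.succAbove) (𝒢.face i x) := by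
  obtain ⟨c, hc, rfl⟩ := exists_quot hx
  rw [conj_quot hc hk, face_quot _ hc, face_quot _ (tgt_mul_congr hc hk),
    conj_quot (c := c ∘ i.succAbove) (k := k ∘ i.succAbove) (fun _ _ => hc _ _) (fun _ => hk _)]
  rfl

namespace WideSubgroupoid

variable {𝒦 : 𝒢.WideSubgroupoid EK K}

theorem incl_unit (m : M) : 𝒦.incl (𝒦.unit m) = 𝒢.unit m := by
  have h1 : 𝒢.src (𝒦.incl (𝒦.unit m)) = m := by rw [𝒦.src_incl, 𝒦.src_unit]
  have h2 : 𝒢.tgt (𝒦.incl (𝒦.unit m)) = m := by rw [𝒦.tgt_incl, 𝒦.tgt_unit]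
  have h3 : 𝒢.mul (𝒦.incl (𝒦.unit m)) (𝒦.incl (𝒦.unit m)) = 𝒦.incl (𝒦.unit m) := by
    rw [← 𝒦.incl_mul _ _ (by rw [𝒦.src_unit, 𝒦.tgt_unit])]
    have h := 𝒦.mul_unit (𝒦.unit m)
    rw [𝒦.src_unit] at h
    rw [h]
  -- an idempotent arrow is a unit
  have h4 := inv_mul_cancel_left (𝒢 := 𝒢) (h1.trans h2.symm)
  rw [h3, 𝒢.inv_mul, h1] at h4
  exact h4.symm

theorem incl_inv (k : K) : 𝒦.incl (𝒦.inv k) = 𝒢.inv (𝒦.incl k) := by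
  have h : 𝒢.src (𝒦.incl k) = 𝒢.tgt (𝒦.incl (𝒦.inv k)) := by
    rw [𝒦.src_incl, 𝒦.tgt_incl, 𝒦.tgt_inv]
  rw [← inv_mul_cancel_left h, ← 𝒦.incl_mul _ _ (𝒦.tgt_inv k).symm, 𝒦.mul_inv, incl_unit,
    ← 𝒦.tgt_incl, ← 𝒢.src_inv, 𝒢.mul_unit]

/-! ### Invariance under conjugation -/

/-- An invariant cochain does not change when each `c_i` in `(c₀⁻¹ c₁, …, c_{p-1}⁻¹ c_p)` is
multiplied on the right by an arrow of `K`: the factors are inserted one at a time. -/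
theorem IsInvariant.quot_mul {Z : Set M} {p : ℕ} {f : 𝒢.nerve Z p → ℝ}
    (hf : 𝒦.IsInvariant Z p f) {c : Fin (p + 1) → G} (hc : ∀ i j, 𝒢.tgt (c i) = 𝒢.tgt (c j))
    {a : Fin (p + 1) → K} (ha : ∀ i, 𝒢.tgt (𝒦.incl (a i)) = 𝒢.src (c i))
    (haZ : ∀ i, 𝒢.src (𝒦.incl (a i)) ∈ Z) (h1 : 𝒢.quot c ∈ 𝒢.nerve Z p)
    (h2 : 𝒢.quot (fun i => 𝒢.mul (c i) (𝒦.incl (a i))) ∈ 𝒢.nerve Z p) :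
    f ⟨_, h2⟩ = f ⟨_, h1⟩ := by
  let b : Fin (p + 1) → G := fun i => 𝒢.mul (c i) (𝒦.incl (a i))
  have key : ∀ s : Finset (Fin (p + 1)), ∃ h : 𝒢.quot (s.piecewise b c) ∈ 𝒢.nerve Z p,
      f ⟨_, h⟩ = f ⟨_, h1⟩ := by
    intro s
    induction s using Finset.induction_on with
    | empty => exact ⟨by rwa [Finset.piecewise_empty], by congr 2⟩
    | insert i s hi ih =>
      obtain ⟨h, ih⟩ := ih
      have hi' : s.piecewise b c i = c i := Finset.piecewise_eq_of_notMem _ _ _ hi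
      have ht : ∀ j l, 𝒢.tgt (s.piecewise b c j) = 𝒢.tgt (s.piecewise b c l) := by
        have h0 : ∀ j, 𝒢.tgt (s.piecewise b c j) = 𝒢.tgt (c 0) := by
          intro j
          by_cases hj : j ∈ s
          · rw [Finset.piecewise_eq_of_mem _ _ _ hj]
            exact (𝒢.tgt_mul _ _ (ha j).symm).trans (hc _ _)
          · rw [Finset.piecewise_eq_of_notMem _ _ _ hj]
            exact hc _ _
        exact fun j l => (h0 j).trans (h0 l).symm
      have hai : 𝒢.tgt (𝒦.incl (a i)) = 𝒢.src (s.piecewise b c i) := by rw [hi', ha]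
      have hact := act_quot ht hai
      rw [hi'] at hact
      rw [Finset.piecewise_insert, show b i = 𝒢.mul (c i) (𝒦.incl (a i)) from rfl, ← hact]
      exact ⟨act_mem h hai (haZ i), (hf i (a i) ⟨_, h⟩ hai (haZ i)).trans ih⟩
  obtain ⟨h, hfin⟩ := key Finset.univ
  simp only [Finset.piecewise_univ] at h hfin
  exact hfin

/-- An invariant cochain takes the same value on `x` and on
`(k₀⁻¹ g₁ k₁, …, k_{p-1}⁻¹ g_p k_p)`. -/
theorem IsInvariant.conj_eq {Z : Set M} {p : ℕ} {f : 𝒢.nerve Z p → ℝ}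
    (hf : 𝒦.IsInvariant Z p f) (x : 𝒢.nerve Z p) {k : Fin (p + 1) → K}
    (hk : ∀ i, 𝒦.tgt (k i) = x.1.1 i) (hkZ : ∀ i, 𝒦.src (k i) ∈ Z)
    (h : 𝒢.conj (fun i => 𝒦.incl (k i)) x.1 ∈ 𝒢.nerve Z p) : f ⟨_, h⟩ = f x := by
  obtain ⟨x, hx⟩ := x
  obtain ⟨c, hc, rfl⟩ := exists_quot hx
  have hk' : ∀ i, 𝒢.tgt (𝒦.incl (k i)) = 𝒢.src (c i) := fun i => (𝒦.tgt_incl _).trans (hk i)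
  simp only [conj_quot hc hk'] at h ⊢
  exact hf.quot_mul hc hk' (fun i => by rw [𝒦.src_incl]; exact hkZ i) hx h

/-- The extension of an invariant cochain does not depend on the arrows used to define it. -/
theorem IsInvariant.conjTo_eq {z : M} {p : ℕ} {f : 𝒢.nerve {z} p → ℝ}
    (hf : 𝒦.IsInvariant {z} p f) (x : 𝒢.nerve Set.univ p) {k k' : Fin (p + 1) → K}
    (hs : ∀ i, 𝒦.src (k i) = z) (ht : ∀ i, 𝒦.tgt (k i) = x.1.1 i)
    (hs' : ∀ i, 𝒦.src (k' i) = z) (ht' : ∀ i, 𝒦.tgt (k' i) = x.1.1 i) :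
    f (𝒦.conjTo x k hs ht) = f (𝒦.conjTo x k' hs' ht') := by
  obtain ⟨x, hx⟩ := x
  obtain ⟨c, hc, rfl⟩ := exists_quot hx
  have hk : ∀ i, 𝒢.tgt (𝒦.incl (k i)) = 𝒢.src (c i) := fun i => (𝒦.tgt_incl _).trans (ht i)
  have hk' : ∀ i, 𝒢.tgt (𝒦.incl (k' i)) = 𝒢.src (c i) := fun i => (𝒦.tgt_incl _).trans (ht' i)
  have htt : ∀ i, 𝒦.tgt (k' i) = 𝒦.tgt (k i) := fun i => (ht' i).trans (ht i).symm
  have m := (𝒦.conjTo ⟨_, hx⟩ k hs ht).2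
  have m' := (𝒦.conjTo ⟨_, hx⟩ k' hs' ht').2
  simp only [conjTo, conj_quot hc hk, conj_quot hc hk'] at m m' ⊢
  -- `k'_i = k_i a_i` with `a_i` in the isotropy group at `z`
  let a : Fin (p + 1) → K := fun i => 𝒦.mul (𝒦.inv (k i)) (k' i)
  have hc1 : ∀ i, 𝒦.src (𝒦.inv (k i)) = 𝒦.tgt (k' i) := fun i => by rw [𝒦.src_inv, htt]
  have hta : ∀ i, 𝒦.tgt (a i) = 𝒦.src (k i) := fun i => by
    rw [𝒦.tgt_mul _ _ (hc1 i), 𝒦.tgt_inv]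
  have hka : ∀ i, 𝒢.mul (𝒦.incl (k i)) (𝒦.incl (a i)) = 𝒦.incl (k' i) := fun i => by
    rw [← 𝒦.incl_mul _ _ (hta i).symm, mul_inv_cancel_left (htt i).symm]
  have hga : ∀ i, 𝒢.src (𝒦.incl (k i)) = 𝒢.tgt (𝒦.incl (a i)) := fun i => by
    rw [𝒦.src_incl, 𝒦.tgt_incl, hta]
  have e : (fun i => 𝒢.mul (c i) (𝒦.incl (k' i))) =
      fun i => 𝒢.mul (𝒢.mul (c i) (𝒦.incl (k i))) (𝒦.incl (a i)) := funext fun i => by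
    rw [𝒢.mul_assoc _ _ _ (hk i).symm (hga i), hka]
  simp only [e] at m' ⊢
  refine (hf.quot_mul (tgt_mul_congr hc hk) (fun i => ?_) (fun i => ?_) m m').symm
  · rw [𝒢.src_mul _ _ (hk i).symm, hga]
  · rw [𝒦.src_incl, 𝒦.src_mul _ _ (hc1 i)]
    exact hs' i

/-! ### Extension of cochains from the isotropy group -/

section Extension

variable {z : M} {κ : M → K} (hs : ∀ m, 𝒦.src (κ m) = z) (ht : ∀ m, 𝒦.tgt (κ m) = m)

/-- The extension of a cochain of the isotropy group at `z`, by means of a choice of arrows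
`κ m ∈ K` from `z` to `m`. No regularity of `κ` is assumed. -/
def extend {p : ℕ} (f : 𝒢.nerve {z} p → ℝ) : 𝒢.nerve Set.univ p → ℝ := fun x =>
  f (𝒦.conjTo x (fun i => κ (x.1.1 i)) (fun _ => hs _) (fun _ => ht _))

theorem diff_extend {p : ℕ} (f : 𝒢.nerve {z} p → ℝ) :
    𝒢.diff Set.univ p (extend hs ht f) = extend hs ht (𝒢.diff {z} p f) := by
  funext x
  simp only [diff, extend, LinearMap.coe_mk, AddHom.coe_mk]
  refine Finset.sum_congr rfl fun i _ => congrArg ((-1 : ℝ) ^ (i : ℕ) * ·)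
    (congrArg f (Subtype.ext ?_))
  exact (face_conj i x.2 fun _ => (𝒦.tgt_incl _).trans (ht _)).symm

theorem cup_extend {p q : ℕ} (f₁ : 𝒢.nerve {z} p → ℝ) (f₂ : 𝒢.nerve {z} q → ℝ) :
    extend hs ht (𝒢.cup f₁ f₂) = 𝒢.cup (extend hs ht f₁) (extend hs ht f₂) :=
  rfl

theorem IsInvariant.extend {p : ℕ} {f : 𝒢.nerve {z} p → ℝ} (hf : 𝒦.IsInvariant {z} p f) :
    𝒦.IsInvariant Set.univ p (extend hs ht f) := by
  intro i l x htl hsl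
  -- conjugating after the action of `l` is conjugating with `l κ_i` in place of `κ_i`
  let k : Fin (p + 1) → K := Function.update (fun j => κ (x.1.1 j)) i (𝒦.mul l (κ (𝒦.src l)))
  have hl : 𝒦.src l = 𝒦.tgt (κ (𝒦.src l)) := (ht _).symm
  have hks : ∀ j, 𝒦.src (k j) = z := by
    intro j
    by_cases hj : j = i
    · subst hj; simp only [k, Function.update_self]; rw [𝒦.src_mul _ _ hl, hs]
    · simp only [k, Function.update_of_ne hj, hs]
  have hkt : ∀ j, 𝒦.tgt (k j) = x.1.1 j := by
    intro j
    by_cases hj : j = i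
    · subst hj; simp only [k, Function.update_self]
      rw [𝒦.tgt_mul _ _ hl, ← 𝒦.tgt_incl, htl]
    · simp only [k, Function.update_of_ne hj, ht]
  refine Eq.trans (congrArg f (Subtype.ext ?_)) (hf.conjTo_eq x hks hkt
    (fun _ => hs _) fun _ => ht _)
  obtain ⟨x, hx⟩ := x
  obtain ⟨c, hc, rfl⟩ := exists_quot hx
  have htl' : 𝒢.tgt (𝒦.incl l) = 𝒢.src (c i) := htl
  change 𝒢.conj (fun j => 𝒦.incl (κ ((𝒢.act i (𝒦.incl l) (𝒢.quot c)).1 j)))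
    (𝒢.act i (𝒦.incl l) (𝒢.quot c)) = 𝒢.conj (fun j => 𝒦.incl (k j)) (𝒢.quot c)
  have hc' : ∀ j j', 𝒢.tgt (Function.update c i (𝒢.mul (c i) (𝒦.incl l)) j) =
      𝒢.tgt (Function.update c i (𝒢.mul (c i) (𝒦.incl l)) j') := by
    have h0 : ∀ j, 𝒢.tgt (Function.update c i (𝒢.mul (c i) (𝒦.incl l)) j) = 𝒢.tgt (c i) := by
      intro j
      by_cases hj : j = i
      · subst hj; rw [Function.update_self, 𝒢.tgt_mul _ _ htl'.symm]
      · rw [Function.update_of_ne hj]; exact hc _ _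
    exact fun j j' => (h0 j).trans (h0 j').symm
  rw [act_quot hc htl', conj_quot hc (fun j => (𝒦.tgt_incl _).trans (hkt j))]
  refine (conj_quot hc' (fun j => (𝒦.tgt_incl _).trans (ht _))).trans ?_
  congr 1
  funext j
  by_cases hj : j = i
  · subst hj
    have e1 : 𝒢.src (𝒢.mul (c j) (𝒦.incl l)) = 𝒦.src l := by
      rw [𝒢.src_mul _ _ htl'.symm, 𝒦.src_incl]
    simp only [quot, k, Function.update_self, e1]
    rw [𝒦.incl_mul _ _ hl, 𝒢.mul_assoc _ _ _ htl'.symm (by rw [𝒦.src_incl, 𝒦.tgt_incl, ← hl])]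
  · simp only [quot, k, Function.update_of_ne hj]

theorem IsNormalized.extend {p : ℕ} {f : 𝒢.nerve {z} p → ℝ} (hf : 𝒦.IsNormalized {z} p f) :
    𝒦.IsNormalized Set.univ p (extend hs ht f) := by
  rintro x ⟨j, l, hl⟩
  have h1 : 𝒦.tgt l = x.1.1 j.castSucc := by rw [← 𝒦.tgt_incl, ← hl]; exact (x.2.2 j).1
  have h2 : 𝒦.src l = x.1.1 j.succ := by rw [← 𝒦.src_incl, ← hl]; exact (x.2.2 j).2
  have h3 : 𝒦.src (𝒦.inv (κ (x.1.1 j.castSucc))) = 𝒦.tgt l := by rw [𝒦.src_inv, ht, h1]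
  refine hf _ ⟨j, 𝒦.mul (𝒦.mul (𝒦.inv (κ (x.1.1 j.castSucc))) l) (κ (x.1.1 j.succ)), ?_⟩
  rw [𝒦.incl_mul _ _ (by rw [𝒦.src_mul _ _ h3, h2, ht]), 𝒦.incl_mul _ _ h3, incl_inv, ← hl]
  rfl

theorem extend_restrict {p : ℕ} {f : 𝒢.nerve Set.univ p → ℝ} (hf : 𝒦.IsInvariant Set.univ p f) :
    extend hs ht (fun x : 𝒢.nerve {z} p => f ⟨x.1, nerve_mono (Set.subset_univ {z}) p x.2⟩) = f :=
  funext fun x => hf.conj_eq x (fun _ => ht _) (fun _ => Set.mem_univ _) _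

theorem restrict_extend {p : ℕ} {f : 𝒢.nerve {z} p → ℝ} (hf : 𝒦.IsInvariant {z} p f) :
    (fun x : 𝒢.nerve {z} p =>
      extend hs ht f ⟨x.1, nerve_mono (Set.subset_univ {z}) p x.2⟩) = f :=
  funext fun x => hf.conj_eq x (fun _ => ht _) (fun _ => hs _) _

/-- Although `κ` need not be continuous, the extension of a smooth invariant cochain is smooth, as
`κ` may be replaced locally by smooth sections of the target map on the source fibre at `z`. -/
theorem isSmooth_extend [FiniteDimensional ℝ EM] [FiniteDimensional ℝ EK]
    [IsManifold 𝓘(ℝ, EM) ∞ M] [SecondCountableTopology K] (hK : 𝒦.toLieGroupoid.IsTransitive)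
    {p : ℕ} {f : 𝒢.nerve {z} p → ℝ} (hf : f ∈ 𝒦.cochains {z} p) :
    𝒢.IsSmooth Set.univ p (extend hs ht f) := by
  obtain ⟨⟨F, hF, hFf⟩, hinv⟩ := hf
  refine ⟨fun x => F (𝒢.conj (fun i => 𝒦.incl (κ (x.1 i))) x), fun x₀ hx₀ => ?_,
    fun x => hFf (𝒦.conjTo x (fun i => κ (x.1.1 i)) (fun _ => hs _) (fun _ => ht _))⟩
  choose σ hσ hσ' using fun i => hK.exists_local_section z (x₀.1 i)
  let s : Set (Tuples M G p) :=
    {x | x ∈ 𝒢.nerve Set.univ p ∧ ∀ i, 𝒦.src (σ i (x.1 i)) = z ∧ 𝒦.tgt (σ i (x.1 i)) = x.1 i}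
  have hs𝓝 : s ∈ 𝓝[𝒢.nerve Set.univ p] x₀ := by
    refine Filter.inter_mem self_mem_nhdsWithin (nhdsWithin_le_nhds ?_)
    refine Filter.eventually_all.2 fun i => ?_
    have hcont : Continuous fun x : Tuples M G p => x.1 i := by fun_prop
    exact hcont.continuousAt.eventually (hσ' i)
  have hx₀s : x₀ ∈ s := mem_of_mem_nhdsWithin hx₀ hs𝓝
  refine ContMDiffWithinAt.mono_of_mem_nhdsWithin ?_ hs𝓝
  -- near `x₀` the extension is `F ∘ Ψ`, where `Ψ` conjugates by the smooth sections `σ i`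
  let Ψ : Tuples M G p → Tuples M G p := fun x => 𝒢.conj (fun i => 𝒦.incl (σ i (x.1 i))) x
  have hΨmem : ∀ x ∈ s, Ψ x ∈ 𝒢.nerve {z} p := fun x hx =>
    (𝒦.conjTo ⟨x, hx.1⟩ (fun i => σ i (x.1 i)) (fun i => (hx.2 i).1) fun i => (hx.2 i).2).2
  have hk : ∀ i, ContMDiffWithinAt (tuplesModel EM EG p) 𝓘(ℝ, EG) ∞
      (fun x : Tuples M G p => 𝒦.incl (σ i (x.1 i))) s x₀ := fun i =>
    ContMDiffAt.comp_contMDiffWithinAt (g := fun m => 𝒦.incl (σ i m)) x₀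
      (𝒦.isImmersion_incl.contMDiff.contMDiffAt.comp _ (hσ i))
      (contMDiffOn_point (EM := EM) (EG := EG) p s i x₀ hx₀s)
  have hmul : ∀ {a b : Tuples M G p → G},
      ContMDiffWithinAt (tuplesModel EM EG p) 𝓘(ℝ, EG) ∞ a s x₀ →
      ContMDiffWithinAt (tuplesModel EM EG p) 𝓘(ℝ, EG) ∞ b s x₀ →
      (∀ x ∈ s, 𝒢.src (a x) = 𝒢.tgt (b x)) →
      ContMDiffWithinAt (tuplesModel EM EG p) 𝓘(ℝ, EG) ∞ (fun x => 𝒢.mul (a x) (b x)) s x₀ :=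
    fun {a b} ha hb hab => ContMDiffWithinAt.comp (f := fun x => (a x, b x)) x₀
      (𝒢.contMDiffOn_mul (a x₀, b x₀) (hab x₀ hx₀s)) (ha.prodMk hb) hab
  have hc : ∀ x ∈ s, ∀ j, 𝒢.src (𝒢.inv (𝒦.incl (σ (Fin.castSucc j) (x.1 (Fin.castSucc j))))) =
      𝒢.tgt (x.2 j) := fun x hx j => by
    rw [𝒢.src_inv, 𝒦.tgt_incl, (hx.2 _).2, (hx.1.2 j).1]
  have hΨ : ContMDiffWithinAt (tuplesModel EM EG p) (tuplesModel EM EG p) ∞ Ψ s x₀ := by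
    refine ContMDiffWithinAt.prodMk (contMDiffWithinAt_pi_iff.2 fun i => ?_)
      (contMDiffWithinAt_pi_iff.2 fun j => ?_)
    · exact 𝒢.isSubmersion_src.contMDiff.contMDiffAt.comp_contMDiffWithinAt x₀ (hk i)
    · refine hmul (hmul (𝒢.contMDiff_inv.contMDiffAt.comp_contMDiffWithinAt x₀ (hk _))
        (contMDiffOn_arrow p s j x₀ hx₀s) fun x hx => hc x hx j) (hk _) fun x hx => ?_
      rw [𝒢.src_mul _ _ (hc x hx j), (hx.1.2 j).2, 𝒦.tgt_incl, (hx.2 _).2]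
  have hcongr : ∀ x ∈ s, F (𝒢.conj (fun i => 𝒦.incl (κ (x.1 i))) x) = F (Ψ x) := by
    intro x hx
    have h1 := hFf (𝒦.conjTo ⟨x, hx.1⟩ (fun i => κ (x.1 i)) (fun _ => hs _) (fun _ => ht _))
    have h2 := hFf (𝒦.conjTo ⟨x, hx.1⟩ (fun i => σ i (x.1 i)) (fun i => (hx.2 i).1)
      fun i => (hx.2 i).2)
    exact h1.trans ((hinv.conjTo_eq _ _ _ _ _).trans h2.symm)
  exact ((hF (Ψ x₀) (hΨmem x₀ hx₀s)).comp x₀ hΨ hΨmem).congr hcongr (hcongr x₀ hx₀s)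

theorem extend_mem [FiniteDimensional ℝ EM] [FiniteDimensional ℝ EK]
    [IsManifold 𝓘(ℝ, EM) ∞ M] [SecondCountableTopology K] (hK : 𝒦.toLieGroupoid.IsTransitive)
    {p : ℕ} {f : 𝒢.nerve {z} p → ℝ} (hf : f ∈ 𝒦.cochains {z} p) :
    extend hs ht f ∈ 𝒦.cochains Set.univ p :=
  ⟨isSmooth_extend hs ht hK hf, hf.2.extend hs ht⟩

theorem extend_mem_norm [FiniteDimensional ℝ EM] [FiniteDimensional ℝ EK]
    [IsManifold 𝓘(ℝ, EM) ∞ M] [SecondCountableTopology K] (hK : 𝒦.toLieGroupoid.IsTransitive)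
    {p : ℕ} {f : 𝒢.nerve {z} p → ℝ} (hf : f ∈ 𝒦.normCochains {z} p) :
    extend hs ht f ∈ 𝒦.normCochains Set.univ p :=
  ⟨extend_mem hs ht hK hf.1, hf.2.extend hs ht⟩

/-- Extension of cochains of the isotropy group at `z`, as an isomorphism of complexes. -/
def extendIso [FiniteDimensional ℝ EM] [FiniteDimensional ℝ EK]
    [IsManifold 𝓘(ℝ, EM) ∞ M] [SecondCountableTopology K]
    (hK : 𝒦.toLieGroupoid.IsTransitive) : 𝒦.isotropyComplex z ≅ 𝒦.relComplex where
  hom := CochainComplex.ofHom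
    (fun p => ModuleCat.ofHom
      { toFun := fun f => (⟨_, extend_mem hs ht hK f.2⟩ : 𝒦.cochains Set.univ p)
        map_add' := fun _ _ => rfl
        map_smul' := fun _ _ => rfl })
    (fun p => by
      rw [complexOn_d, complexOn_d]
      exact ModuleCat.hom_ext (LinearMap.ext fun f => Subtype.ext (diff_extend hs ht f.1)))
  inv := 𝒦.restrict z
  hom_inv_id := HomologicalComplex.hom_ext _ _ fun _ =>
    ModuleCat.hom_ext (LinearMap.ext fun f => Subtype.ext (restrict_extend hs ht f.2.2))
  inv_hom_id := HomologicalComplex.hom_ext _ _ fun _ =>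
    ModuleCat.hom_ext (LinearMap.ext fun f => Subtype.ext (extend_restrict hs ht f.2.2))

/-- Extension of normalized cochains of the isotropy group at `z`, as an isomorphism of
complexes. -/
def normExtendIso [FiniteDimensional ℝ EM] [FiniteDimensional ℝ EK]
    [IsManifold 𝓘(ℝ, EM) ∞ M] [SecondCountableTopology K]
    (hK : 𝒦.toLieGroupoid.IsTransitive) : 𝒦.normIsotropyComplex z ≅ 𝒦.normRelComplex where
  hom := CochainComplex.ofHom
    (fun p => ModuleCat.ofHom
      { toFun := fun f => (⟨_, extend_mem_norm hs ht hK f.2⟩ : 𝒦.normCochains Set.univ p)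
        map_add' := fun _ _ => rfl
        map_smul' := fun _ _ => rfl })
    (fun p => by
      rw [normComplexOn_d, normComplexOn_d]
      exact ModuleCat.hom_ext (LinearMap.ext fun f => Subtype.ext (diff_extend hs ht f.1)))
  inv := 𝒦.normRestrict z
  hom_inv_id := HomologicalComplex.hom_ext _ _ fun _ =>
    ModuleCat.hom_ext (LinearMap.ext fun f => Subtype.ext (restrict_extend hs ht f.2.1.2))
  inv_hom_id := HomologicalComplex.hom_ext _ _ fun _ =>
    ModuleCat.hom_ext (LinearMap.ext fun f => Subtype.ext (extend_restrict hs ht f.2.1.2))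

end Extension

end WideSubgroupoid

end LieGroupoid

theorem mainTheorem6
    {EM : Type uEM} [NormedAddCommGroup EM] [NormedSpace ℝ EM] [FiniteDimensional ℝ EM]
    {EG : Type uEG} [NormedAddCommGroup EG] [NormedSpace ℝ EG] [FiniteDimensional ℝ EG]
    {EK : Type uEK} [NormedAddCommGroup EK] [NormedSpace ℝ EK] [FiniteDimensional ℝ EK]
    {M : Type uM} [TopologicalSpace M] [ChartedSpace EM M] [IsManifold 𝓘(ℝ, EM) ∞ M] [T2Space M]
    {G : Type uG} [TopologicalSpace G] [ChartedSpace EG G] [IsManifold 𝓘(ℝ, EG) ∞ G] [T2Space G]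
    {K : Type uK} [TopologicalSpace K] [ChartedSpace EK K] [IsManifold 𝓘(ℝ, EK) ∞ K]
    [SecondCountableTopology K]
    (𝒢 : LieGroupoid EM EG M G) (𝒦 : 𝒢.WideSubgroupoid EK K)
    (hK : 𝒦.toLieGroupoid.IsTransitive) (z : M) :
    (∃ ext : 𝒦.isotropyComplex z ≅ 𝒦.relComplex,
      (∀ (p : ℕ) (f : 𝒦.cochains {z} p) (x : 𝒢.nerve Set.univ p) (k : Fin (p + 1) → K)
        (hs : ∀ i, 𝒦.src (k i) = z) (ht : ∀ i, 𝒦.tgt (k i) = x.1.1 i),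
        (𝒦.mapAt ext.hom p f).1 x = f.1 (𝒦.conjTo x k hs ht)) ∧
      ext.inv = 𝒦.restrict z ∧
      (∀ (p q : ℕ) (f₁ : 𝒦.cochains {z} p) (f₂ : 𝒦.cochains {z} q),
        𝒦.mapAt ext.hom (p + q) (𝒦.cup f₁ f₂) =
          𝒦.cup (𝒦.mapAt ext.hom p f₁) (𝒦.mapAt ext.hom q f₂)) ∧
      (∀ (p q : ℕ) (f₁ : 𝒦.cochains Set.univ p) (f₂ : 𝒦.cochains Set.univ q),
        𝒦.mapAt (𝒦.restrict z) (p + q) (𝒦.cup f₁ f₂) =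
          𝒦.cup (𝒦.mapAt (𝒦.restrict z) p f₁) (𝒦.mapAt (𝒦.restrict z) q f₂))) ∧
    (∃ ext : 𝒦.normIsotropyComplex z ≅ 𝒦.normRelComplex,
      (∀ (p : ℕ) (f : 𝒦.normCochains {z} p) (x : 𝒢.nerve Set.univ p) (k : Fin (p + 1) → K)
        (hs : ∀ i, 𝒦.src (k i) = z) (ht : ∀ i, 𝒦.tgt (k i) = x.1.1 i),
        (𝒦.normMapAt ext.hom p f).1 x = f.1 (𝒦.conjTo x k hs ht)) ∧
      ext.inv = 𝒦.normRestrict z ∧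
      (∀ (p q : ℕ) (f₁ : 𝒦.normCochains {z} p) (f₂ : 𝒦.normCochains {z} q),
        𝒦.normMapAt ext.hom (p + q) (𝒦.normCup f₁ f₂) =
          𝒦.normCup (𝒦.normMapAt ext.hom p f₁) (𝒦.normMapAt ext.hom q f₂)) ∧
      (∀ (p q : ℕ) (f₁ : 𝒦.normCochains Set.univ p) (f₂ : 𝒦.normCochains Set.univ q),
        𝒦.normMapAt (𝒦.normRestrict z) (p + q) (𝒦.normCup f₁ f₂) =
          𝒦.normCup (𝒦.normMapAt (𝒦.normRestrict z) p f₁)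
            (𝒦.normMapAt (𝒦.normRestrict z) q f₂))) := by
  choose κ hs ht using fun m => hK z m
  refine ⟨⟨LieGroupoid.WideSubgroupoid.extendIso hs ht hK, ?_, rfl,
      fun _ _ _ _ => rfl, fun _ _ _ _ => rfl⟩,
    ⟨LieGroupoid.WideSubgroupoid.normExtendIso hs ht hK, ?_, rfl,
      fun _ _ _ _ => rfl, fun _ _ _ _ => rfl⟩⟩
  · exact fun _ f x _ _ _ => f.2.2.conjTo_eq x _ _ _ _
  · exact fun _ f x _ _ _ => f.2.1.2.conjTo_eq x _ _ _ _
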